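/- Conventions. Let $G$ be a finitely generated group. Below, $S$ and $T$ denote finite symmetric generating sets of $G$ ($1\in S=S^{-1}$, $S$ generates $G$). Let $|\cdot|$ be the word length and $d(g,h)=|g^{-1}h|$ the word metric with respect to $S$, and let $B(n)$ and $S(n)$ be the closed ball and the sphere of radius $n$ centred at the identity $e$ (so that $\#B(n)$ counts the elements of length at most $n$). Growth. $\mathrm{gr}(G,S)=\lim_{n}\frac1n\log\#B(n)$ and $\mathrm{gr}_{\min}(G)=\inf_S\mathrm{gr}(G,S)$. Relative growth. For $m\in\mathbb N$, $\epsilon>0$, $\lambda\in(0,1)$, let $N_0(n;m,\epsilon,\lambda)$ be the maximal cardinality of a set $A\subseteq S(mn)$ such that for all $x,y\in A$ there are sequences $(x_0,\dots,x_n)$, $(y_0,\dots,y_n)$ in $G$ with $x_j,y_j\in S(jm)$, $x_0=y_0=e$, $x_n=x$, $y_n=y$, $d(x_j,x_{j+1})\le m+\lambda\epsilon$ and $d(y_j,y_{j+1})\le m+\lambda\epsilon$ for all $j<n$, and, if $k<n$ is the maximal index for which $x_k=y_k$, $d(x_{k+1},y_{k+1})\ge\epsilon$. For functions $\mu:(0,1)\times\mathbb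 R_+\to\mathbb N$ and $\tau:(0,1)\to\mathbb R_+$ put $$\mathrm{gr}^{\mathrm{rel}}(G,S;\mu,\tau)=\sup\Big\{\limsup_{n}\tfrac1{mn}\log N_0(n;m,\epsilon,\lambda)\ :\ \lambda\in(0,1),\ \epsilon>\tau(\lambda),\ m>\mu(\lambda,\epsilon)\Big\},$$ and, given bounds $\mu_S,\tau_S$ for every $S$, $\mathrm{gr}^{\mathrm{rel}}_{\min}(G)=\inf_S\mathrm{gr}^{\mathrm{rel}}(G,S;\mu_S,\tau_S)$. Boundary entropy. Let $\partial_TG$ be the Gromov boundary of the Cayley graph $C(G,T)$ (a metric graph with edges of length $1$): the set of classes of sequences $(x_n)$ in $C(G,T)$ with $(x_m|x_n)\to\infty$, where $(y|z)=\frac12(d(e,y)+d(e,z)-d(y,z))$ and $(x_n)\sim(y_n)$ if $(x_m|y_n)\to\infty$ as $m,n\to\infty$. For $\xi,\zeta\in\partial_TG$ let $(\xi|\zeta)=\sup\liminf_{m,n\to\infty}(x_m|y_n)$ over all representatives, and for $\eta>0$ let $\rho_\eta(\xi,\zeta)=e^{-\eta(\xi|\zeta)}$ and $d_\eta(\xi,\zeta)=\inf\sum_{i=0}^{k}\rho_\eta(\xi_i,\xi_{i+1})$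 over all finite chains $\xi=\xi_0,\dots,\xi_{k+1}=\zeta$ in $\partial_TG$. The group $G$ acts on $\partial_TG$ by left translations. The boundary entropy of $G$ with respect to $S$ is $$h(G,S;\partial_TG,d_\eta)=\lim_{\theta\to0}\limsup_{n\to\infty}\frac1n\log N(n,\theta),$$ where $N(n,\theta)$ is the maximal number of points $\xi\in\partial_TG$ such that any two of them, $\xi\ne\zeta$, satisfy $d_\eta(g\xi,g\zeta)\ge\theta$ for some $g\in B(n)$, the ball with respect to $S$. Given, for every $S$, a finite symmetric generating set $T_S$ and $\eta_S>0$ such that $d_{\eta_S}$ is a distance function on $\partial_{T_S}G$ (for example $T_S=S$, or $T_S$ independent of $S$), put $h_{\min}(G,\partial G)=\inf_Sh(G,S;\partial_{T_S}G,d_{\eta_S})$. Theorem. Let $k\ge1$ and let $F_k$ be the free group of rank $k$. For every finite symmetric generating set $T$ of $F_k$ there is $\eta_0>0$ such that $d_\eta$ is a distance function on $\partial_TF_k$ for all $0<\eta<\eta_0$. For every choice of $(T_S,\eta_S)$ as above and of functions $(\mu_S,\tau_S)$, $$h_{\min}(F_k,\partial F_k)=\mathrm{gr}_{\min}(F_k)=\mathrm{gr}^{\mathrm{rel}}_{\min}(F_k)=\log(2k-1).$$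 -/

import Mathlib

open Filter Topology
open scoped ENNReal NNReal

noncomputable section

/-- Finite symmetric generating sets of a group: finite sets `S` with `1 ∈ S` and `S⁻¹ = S` that
generate the group. -/
structure SymGenSet (G : Type*) [Group G] where
  carrier : Finset G
  one_mem : (1 : G) ∈ carrier
  inv_mem : ∀ s ∈ carrier, s⁻¹ ∈ carrier
  closure_eq_top : Subgroup.closure (carrier : Set G) = ⊤

namespace SymGenSet

variable {G : Type*} [Group G] (S : SymGenSet G)

/-- `g` is a product of `n` elements of `S`. -/
def IsProdOf (n : ℕ) (g : G) : Prop :=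
  ∃ l : List G, l.length = n ∧ (∀ s ∈ l, s ∈ S.carrier) ∧ l.prod = g

/-- The length `|g|` of `g` with respect to `S`. -/
def length (g : G) : ℕ := sInf {n | S.IsProdOf n g}

/-- The word distance `d_S(g, h) = |g⁻¹ h|`. -/
def wdist (g h : G) : ℝ := S.length (g⁻¹ * h)

/-- The closed ball `B(n)` centred at the identity. -/
def ball (n : ℕ) : Set G := {g | S.length g ≤ n}

/-- The sphere `S(n)` centred at the identity. -/
def sphere (n : ℕ) : Set G := {g | S.length g = n}

theorem exists_isProdOf (g : G) : ∃ n, S.IsProdOf n g := by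
  have hg : g ∈ Subgroup.closure (S.carrier : Set G) := by
    rw [S.closure_eq_top]; exact Subgroup.mem_top g
  induction hg using Subgroup.closure_induction with
  | mem x hx => exact ⟨1, [x], rfl, by simpa using hx, by simp⟩
  | one => exact ⟨0, [], rfl, by simp, rfl⟩
  | mul x y _ _ hx hy =>
    obtain ⟨_, l, _, hl, rfl⟩ := hx
    obtain ⟨_, l', _, hl', rfl⟩ := hy
    refine ⟨_, l ++ l', rfl, ?_, by simp⟩
    intro s hs
    rcases List.mem_append.1 hs with h | h
    exacts [hl s h, hl' s h]
  | inv x _ hx =>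
    obtain ⟨_, l, _, hl, rfl⟩ := hx
    refine ⟨_, (l.map fun s => s⁻¹).reverse, rfl, ?_, (List.prod_inv_reverse l).symm⟩
    intro s hs
    obtain ⟨a, ha, rfl⟩ := List.mem_map.1 (List.mem_reverse.1 hs)
    exact S.inv_mem a (hl a ha)

theorem isProdOf_length (g : G) : S.IsProdOf (S.length g) g :=
  Nat.sInf_mem (S.exists_isProdOf g)

theorem length_mul_le (g h : G) : S.length (g * h) ≤ S.length g + S.length h := by
  obtain ⟨l, hl, hl1, hl2⟩ := S.isProdOf_length g
  obtain ⟨l', hl', hl1', hl2'⟩ := S.isProdOf_length h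
  refine Nat.sInf_le ⟨l ++ l', by simp [hl, hl'], ?_, by simp [hl2, hl2']⟩
  intro s hs
  rcases List.mem_append.1 hs with h | h
  exacts [hl1 s h, hl1' s h]

theorem length_one : S.length (1 : G) = 0 :=
  Nat.le_zero.1 (Nat.sInf_le ⟨[], rfl, by simp, rfl⟩)

theorem length_inv_le (g : G) : S.length g⁻¹ ≤ S.length g := by
  obtain ⟨l, hl, hl1, hl2⟩ := S.isProdOf_length g
  refine Nat.sInf_le ⟨(l.map fun s => s⁻¹).reverse, by simp [hl], ?_, ?_⟩
  · intro s hs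
    obtain ⟨a, ha, rfl⟩ := List.mem_map.1 (List.mem_reverse.1 hs)
    exact S.inv_mem a (hl1 a ha)
  · rw [← List.prod_inv_reverse, hl2]

theorem wdist_self (g : G) : S.wdist g g = 0 := by simp [wdist, length_one]

theorem wdist_comm (g h : G) : S.wdist g h = S.wdist h g := by
  have h1 : ∀ a b : G, S.wdist a b ≤ S.wdist b a := fun a b => by
    have := S.length_inv_le (b⁻¹ * a)
    rw [mul_inv_rev, inv_inv] at this
    simp only [wdist]
    exact_mod_cast this
  exact le_antisymm (h1 g h) (h1 h g)

theorem wdist_triangle (a b c : G) : S.wdist a c ≤ S.wdist a b + S.wdist b c := by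
  have := S.length_mul_le (a⁻¹ * b) (b⁻¹ * c)
  rw [mul_assoc, mul_inv_cancel_left] at this
  simp only [wdist]
  exact_mod_cast this

theorem wdist_nonneg (a b : G) : 0 ≤ S.wdist a b := Nat.cast_nonneg _

theorem wdist_mul_left (g a b : G) : S.wdist (g * a) (g * b) = S.wdist a b := by
  simp [wdist, mul_assoc]

end SymGenSet

/-- Points of the Cayley graph `C(G, S)` (its geometric realization): the point at parameter
`t ∈ [0, 1]` on the edge from the vertex `src` to the vertex `src * dir`, where `dir ∈ S`. If
`dir = 1` this edge is degenerate, i.e. the point is the vertex `src`. Different triples may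
represent the same point; they are then at distance `0`. -/
@[ext]
structure CayleyGraph {G : Type*} [Group G] (S : SymGenSet G) where
  src : G
  dir : G
  dir_mem : dir ∈ S.carrier
  t : ℝ
  t_mem : t ∈ Set.Icc (0 : ℝ) 1

namespace CayleyGraph

variable {G : Type*} [Group G] {S : SymGenSet G}

/-- The end vertex of the edge. -/
def tgt (p : CayleyGraph S) : G := p.src * p.dir

/-- The distance along the edge to its initial vertex (edges have length `1`, degenerate ones
have length `0`). -/
def toSrc (p : CayleyGraph S) : ℝ := p.t * S.wdist p.src p.tgt

/-- The distance along the edge to its end vertex. -/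
def toTgt (p : CayleyGraph S) : ℝ := (1 - p.t) * S.wdist p.src p.tgt

/-- The shortest length of a path from `p` to `q` through endpoints of their edges. -/
def viaVertices (p q : CayleyGraph S) : ℝ :=
  min
    (min (p.toSrc + S.wdist p.src q.src + q.toSrc) (p.toSrc + S.wdist p.src q.tgt + q.toTgt))
    (min (p.toTgt + S.wdist p.tgt q.src + q.toSrc) (p.toTgt + S.wdist p.tgt q.tgt + q.toTgt))

open Classical in
/-- The path metric of the Cayley graph: along the edge for two points of the same (unoriented)
edge, and through endpoints otherwise. -/
def pdist (p q : CayleyGraph S) : ℝ :=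
  if p.src = q.src ∧ p.tgt = q.tgt then |p.toSrc - q.toSrc|
  else if p.src = q.tgt ∧ p.tgt = q.src then |p.toSrc - q.toTgt|
  else viaVertices p q

theorem toSrc_nonneg (p : CayleyGraph S) : 0 ≤ p.toSrc :=
  mul_nonneg p.t_mem.1 (S.wdist_nonneg _ _)

theorem toTgt_nonneg (p : CayleyGraph S) : 0 ≤ p.toTgt :=
  mul_nonneg (sub_nonneg.2 p.t_mem.2) (S.wdist_nonneg _ _)

theorem toSrc_add_toTgt (p : CayleyGraph S) : p.toSrc + p.toTgt = S.wdist p.src p.tgt := by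
  simp only [toSrc, toTgt]; ring

theorem pdist_self (p : CayleyGraph S) : pdist p p = 0 := by simp [pdist]

theorem viaVertices_comm (p q : CayleyGraph S) : viaVertices p q = viaVertices q p := by
  have h := S.wdist_comm
  simp only [viaVertices]
  rw [h q.src p.src, h q.src p.tgt, h q.tgt p.src, h q.tgt p.tgt, min_min_min_comm]
  congr 2 <;> ring_nf

theorem pdist_comm (p q : CayleyGraph S) : pdist p q = pdist q p := by
  have hp := p.toSrc_add_toTgt
  have hq := q.toSrc_add_toTgt
  by_cases h1 : p.src = q.src ∧ p.tgt = q.tgt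
  · rw [pdist, pdist, if_pos h1, if_pos ⟨h1.1.symm, h1.2.symm⟩, abs_sub_comm]
  · have h1' : ¬ (q.src = p.src ∧ q.tgt = p.tgt) := fun h => h1 ⟨h.1.symm, h.2.symm⟩
    by_cases h2 : p.src = q.tgt ∧ p.tgt = q.src
    · rw [pdist, pdist, if_neg h1, if_neg h1', if_pos h2, if_pos ⟨h2.2.symm, h2.1.symm⟩]
      rw [h2.1, h2.2, S.wdist_comm] at hp
      rw [show p.toSrc - q.toTgt = q.toSrc - p.toTgt by linarith]
    · rw [pdist, pdist, if_neg h1, if_neg h1', if_neg h2, if_neg fun h => h2 ⟨h.2.symm, h.1.symm⟩,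
        viaVertices_comm]

/-- The four endpoint paths are at least as long as the distance. -/
theorem pdist_le (p q : CayleyGraph S) :
    pdist p q ≤ p.toSrc + S.wdist p.src q.src + q.toSrc ∧
    pdist p q ≤ p.toSrc + S.wdist p.src q.tgt + q.toTgt ∧
    pdist p q ≤ p.toTgt + S.wdist p.tgt q.src + q.toSrc ∧
    pdist p q ≤ p.toTgt + S.wdist p.tgt q.tgt + q.toTgt := by
  have hp := p.toSrc_add_toTgt
  have hq := q.toSrc_add_toTgt
  have a0 := p.toSrc_nonneg
  have a1 := p.toTgt_nonneg
  have b0 := q.toSrc_nonneg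
  have b1 := q.toTgt_nonneg
  by_cases h1 : p.src = q.src ∧ p.tgt = q.tgt
  · rw [pdist, if_pos h1]
    rw [h1.1, h1.2] at hp ⊢
    rw [S.wdist_self, S.wdist_self, S.wdist_comm q.tgt q.src]
    refine ⟨?_, ?_, ?_, ?_⟩ <;> apply abs_le.2 <;> constructor <;> linarith
  · by_cases h2 : p.src = q.tgt ∧ p.tgt = q.src
    · rw [pdist, if_neg h1, if_pos h2]
      rw [h2.1, h2.2, S.wdist_comm] at hp
      rw [h2.1, h2.2, S.wdist_self, S.wdist_self, S.wdist_comm q.tgt q.src]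
      refine ⟨?_, ?_, ?_, ?_⟩ <;> apply abs_le.2 <;> constructor <;> linarith
    · rw [pdist, if_neg h1, if_neg h2, viaVertices]
      refine ⟨?_, ?_, ?_, ?_⟩ <;> simp

/-- The distance is the length of one of the paths in its definition. -/
theorem pdist_cases (p q : CayleyGraph S) :
    (p.src = q.src ∧ p.tgt = q.tgt ∧ pdist p q = |p.toSrc - q.toSrc|) ∨
    (p.src = q.tgt ∧ p.tgt = q.src ∧ pdist p q = |p.toSrc - q.toTgt|) ∨
    pdist p q = p.toSrc + S.wdist p.src q.src + q.toSrc ∨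
    pdist p q = p.toSrc + S.wdist p.src q.tgt + q.toTgt ∨
    pdist p q = p.toTgt + S.wdist p.tgt q.src + q.toSrc ∨
    pdist p q = p.toTgt + S.wdist p.tgt q.tgt + q.toTgt := by
  by_cases h1 : p.src = q.src ∧ p.tgt = q.tgt
  · exact Or.inl ⟨h1.1, h1.2, by rw [pdist, if_pos h1]⟩
  · by_cases h2 : p.src = q.tgt ∧ p.tgt = q.src
    · exact Or.inr (Or.inl ⟨h2.1, h2.2, by rw [pdist, if_neg h1, if_pos h2]⟩)
    · refine Or.inr (Or.inr ?_)
      rw [pdist, if_neg h1, if_neg h2, viaVertices]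
      rcases min_choice
        (min (p.toSrc + S.wdist p.src q.src + q.toSrc) (p.toSrc + S.wdist p.src q.tgt + q.toTgt))
        (min (p.toTgt + S.wdist p.tgt q.src + q.toSrc) (p.toTgt + S.wdist p.tgt q.tgt + q.toTgt))
        with h | h <;> rw [h]
      · rcases min_choice (p.toSrc + S.wdist p.src q.src + q.toSrc)
          (p.toSrc + S.wdist p.src q.tgt + q.toTgt) with h | h <;> simp [h]
      · rcases min_choice (p.toTgt + S.wdist p.tgt q.src + q.toSrc)
          (p.toTgt + S.wdist p.tgt q.tgt + q.toTgt) with h | h <;> simp [h]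

theorem pdist_of_same {p q : CayleyGraph S} (h0 : p.src = q.src) (h1 : p.tgt = q.tgt) :
    pdist p q = |p.toSrc - q.toSrc| := by rw [pdist, if_pos ⟨h0, h1⟩]

theorem pdist_of_reverse {p q : CayleyGraph S} (h0 : p.src = q.tgt) (h1 : p.tgt = q.src) :
    pdist p q = |p.toSrc - q.toTgt| := by
  by_cases h : p.src = q.src ∧ p.tgt = q.tgt
  · have hq := q.toSrc_add_toTgt
    rw [← h.1, h0, S.wdist_self] at hq
    have b0 := q.toSrc_nonneg
    have b1 := q.toTgt_nonneg
    rw [pdist, if_pos h, show q.toSrc = q.toTgt by linarith]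
  · rw [pdist, if_neg h, if_pos ⟨h0, h1⟩]

theorem pdist_triangle (p q r : CayleyGraph S) : pdist p r ≤ pdist p q + pdist q r := by
  have hp := p.toSrc_add_toTgt
  have hq := q.toSrc_add_toTgt
  have hr := r.toSrc_add_toTgt
  have T := S.wdist_triangle
  have a0 := p.toSrc_nonneg
  have a1 := p.toTgt_nonneg
  have b0 := q.toSrc_nonneg
  have b1 := q.toTgt_nonneg
  have c0 := r.toSrc_nonneg
  have c1 := r.toTgt_nonneg
  have hc := S.wdist_comm q.tgt q.src
  obtain ⟨l1, l2, l3, l4⟩ := pdist_le p r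
  rcases pdist_cases p q with ⟨e0, e1, e⟩ | ⟨e0, e1, e⟩ | e
  · rcases pdist_cases q r with ⟨f0, f1, f⟩ | ⟨f0, f1, f⟩ | f
    · rw [e, f, pdist_of_same (e0.trans f0) (e1.trans f1)]
      exact abs_sub_le _ _ _
    · rw [e, f, pdist_of_reverse (e0.trans f0) (e1.trans f1)]
      exact abs_sub_le _ _ _
    · have u := le_abs_self (p.toSrc - q.toSrc)
      have v := neg_abs_le (p.toSrc - q.toSrc)
      simp only [e0, e1] at hp l1 l2 l3 l4
      rw [e]
      rcases f with f | f | f | f <;> rw [f] <;> linarith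
  · rcases pdist_cases q r with ⟨f0, f1, f⟩ | ⟨f0, f1, f⟩ | f
    · rw [e, f, pdist_of_reverse (e0.trans f1) (e1.trans f0)]
      rw [f0, f1] at hq
      rw [show q.toSrc - r.toSrc = r.toTgt - q.toTgt by linarith, abs_sub_comm r.toTgt]
      exact abs_sub_le _ _ _
    · rw [e, f, pdist_of_same (e0.trans f1) (e1.trans f0)]
      rw [f0, f1, S.wdist_comm] at hq
      rw [show q.toSrc - r.toTgt = r.toSrc - q.toTgt by linarith, abs_sub_comm r.toSrc]
      exact abs_sub_le _ _ _
    · have u := le_abs_self (p.toSrc - q.toTgt)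
      have v := neg_abs_le (p.toSrc - q.toTgt)
      rw [e0, e1, S.wdist_comm] at hp
      simp only [e0, e1] at l1 l2 l3 l4
      rw [e]
      rcases f with f | f | f | f <;> rw [f] <;> linarith
  · rcases pdist_cases q r with ⟨f0, f1, f⟩ | ⟨f0, f1, f⟩ | f
    · have u := le_abs_self (q.toSrc - r.toSrc)
      have v := neg_abs_le (q.toSrc - r.toSrc)
      simp only [← f0, ← f1] at hr l1 l2 l3 l4
      rw [f]
      rcases e with e | e | e | e <;> rw [e] <;> linarith
    · have u := le_abs_self (q.toSrc - r.toTgt)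
      have v := neg_abs_le (q.toSrc - r.toTgt)
      rw [← f0, ← f1, S.wdist_comm] at hr
      simp only [← f0, ← f1] at l1 l2 l3 l4
      rw [f]
      rcases e with e | e | e | e <;> rw [e] <;> linarith
    · rcases e with e | e | e | e <;> rcases f with f | f | f | f <;> rw [e, f] <;>
        linarith [T p.src q.src r.src, T p.src q.src r.tgt, T p.tgt q.src r.src,
          T p.tgt q.src r.tgt, T p.src q.tgt r.src, T p.src q.tgt r.tgt, T p.tgt q.tgt r.src,
          T p.tgt q.tgt r.tgt, T q.src q.tgt r.src, T q.src q.tgt r.tgt, T q.tgt q.src r.src,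
          T q.tgt q.src r.tgt]

instance : PseudoMetricSpace (CayleyGraph S) where
  dist := pdist
  dist_self := pdist_self
  dist_comm := pdist_comm
  dist_triangle := pdist_triangle

/-- The vertex of the Cayley graph given by a group element. -/
def vertex (S : SymGenSet G) (g : G) : CayleyGraph S :=
  ⟨g, 1, S.one_mem, 0, by simp⟩

/-- The action of `G` on its Cayley graph by left translations. -/
instance : MulAction G (CayleyGraph S) where
  smul g p := ⟨g * p.src, p.dir, p.dir_mem, p.t, p.t_mem⟩
  one_smul p := CayleyGraph.ext (one_mul p.src) rfl rfl
  mul_smul g h p := CayleyGraph.ext (mul_assoc g h p.src) rfl rfl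

open Classical in
theorem pdist_smul (g : G) (p q : CayleyGraph S) : pdist (g • p) (g • q) = pdist p q := by
  have h0 : ∀ p : CayleyGraph S, (g • p).src = g * p.src := fun _ => rfl
  have h1 : ∀ p : CayleyGraph S, (g • p).tgt = g * p.tgt := fun _ => mul_assoc _ _ _
  have h2 : ∀ p : CayleyGraph S, (g • p).toSrc = p.toSrc := fun p => by
    rw [toSrc, h0, h1, S.wdist_mul_left]; rfl
  have h3 : ∀ p : CayleyGraph S, (g • p).toTgt = p.toTgt := fun p => by
    rw [toTgt, h0, h1, S.wdist_mul_left]; rfl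
  have h4 : viaVertices (g • p) (g • q) = viaVertices p q := by
    simp only [viaVertices, h0, h1, h2, h3, S.wdist_mul_left]
  have h5 : (g • p).src = (g • q).src ∧ (g • p).tgt = (g • q).tgt ↔
      p.src = q.src ∧ p.tgt = q.tgt := by simp only [h0, h1, mul_right_inj]
  have h6 : (g • p).src = (g • q).tgt ∧ (g • p).tgt = (g • q).src ↔
      p.src = q.tgt ∧ p.tgt = q.src := by simp only [h0, h1, mul_right_inj]
  unfold pdist
  rw [if_congr h5 rfl (if_congr h6 rfl rfl), h2, h2, h3, h4]

instance : IsIsometricSMul G (CayleyGraph S) :=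
  ⟨fun g => Isometry.of_dist_eq (pdist_smul g)⟩

end CayleyGraph

section Boundary

variable {X : Type*} [PseudoMetricSpace X]

/-- The Gromov product `(y|z)` based at `x₀`. -/
def gromovProduct (x₀ y z : X) : ℝ := (dist x₀ y + dist x₀ z - dist y z) / 2

/-- The Gromov products `(x_m|y_n)` tend to infinity as `m, n → ∞`. -/
def GromovEquiv (x₀ : X) (x y : ℕ → X) : Prop :=
  Tendsto (fun p : ℕ × ℕ => gromovProduct x₀ (x p.1) (y p.2)) (atTop ×ˢ atTop) atTop

/-- The sequences diverging to infinity. -/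
def DivergentSeq (x₀ : X) : Type _ := {x : ℕ → X // GromovEquiv x₀ x x}

/-- The boundary of a hyperbolic space: equivalence classes of sequences diverging to infinity.
(For a hyperbolic space the relation is an equivalence relation; in general `Quot` is the quotient
by the equivalence relation that it generates.) -/
def GromovBoundary (x₀ : X) : Type _ :=
  Quot fun x y : DivergentSeq x₀ => GromovEquiv x₀ x.1 y.1

variable {x₀ : X}

/-- The boundary point represented by a sequence diverging to infinity. -/
def GromovBoundary.mk (x : DivergentSeq x₀) : GromovBoundary x₀ := Quot.mk _ x

/-- The extended Gromov product `(ξ|ζ) = sup liminf (x_m|y_n)` of boundary points, the supremum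
being over all sequences representing `ξ` and `ζ`. -/
def boundaryProduct (ξ ζ : GromovBoundary x₀) : EReal :=
  ⨆ (x : DivergentSeq x₀) (y : DivergentSeq x₀)
    (_ : GromovBoundary.mk x = ξ ∧ GromovBoundary.mk y = ζ),
    liminf (fun p : ℕ × ℕ => (gromovProduct x₀ (x.1 p.1) (y.1 p.2) : EReal)) (atTop ×ˢ atTop)

/-- `ρ_η(ξ, ζ) = exp (-η (ξ|ζ))`. -/
def boundaryRho (η : ℝ) (ξ ζ : GromovBoundary x₀) : ℝ≥0∞ :=
  EReal.exp (-((η : EReal) * boundaryProduct ξ ζ))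

/-- `d_η(ξ, ζ)`, the infimum of the sums `∑ ρ_η(ξ_i, ξ_{i+1})`, `0 ≤ i ≤ k`, over all finite chains
`ξ = ξ_0, ξ_1, …, ξ_{k+1} = ζ` in the boundary. -/
def boundaryDist (η : ℝ) (ξ ζ : GromovBoundary x₀) : ℝ≥0∞ :=
  ⨅ (k : ℕ) (c : ℕ → GromovBoundary x₀) (_ : c 0 = ξ ∧ c (k + 1) = ζ),
    ∑ i ∈ Finset.range (k + 1), boundaryRho η (c i) (c (i + 1))

/-- `d_η` is a distance function on the boundary: it is finite and vanishes exactly on the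
diagonal, and it is symmetric and satisfies the triangle inequality. -/
structure IsBoundaryMetric (x₀ : X) (η : ℝ) : Prop where
  ne_top : ∀ ξ ζ : GromovBoundary x₀, boundaryDist η ξ ζ ≠ ⊤
  eq_zero_iff : ∀ ξ ζ : GromovBoundary x₀, boundaryDist η ξ ζ = 0 ↔ ξ = ζ
  symm : ∀ ξ ζ : GromovBoundary x₀, boundaryDist η ξ ζ = boundaryDist η ζ ξ
  triangle : ∀ ξ ζ χ : GromovBoundary x₀,
    boundaryDist η ξ χ ≤ boundaryDist η ξ ζ + boundaryDist η ζ χ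

variable {G : Type*} [Group G] [MulAction G X] [IsIsometricSMul G X]

theorem GromovEquiv.smul {x y : ℕ → X} (h : GromovEquiv x₀ x y) (g : G) :
    GromovEquiv x₀ (fun n => g • x n) (fun n => g • y n) := by
  refine tendsto_atTop_mono (fun p => ?_) (tendsto_atTop_add_const_right _ (-dist x₀ (g • x₀)) h)
  have h1 := dist_triangle (g • x₀) x₀ (g • x p.1)
  have h2 := dist_triangle (g • x₀) x₀ (g • y p.2)
  rw [dist_smul, dist_comm (g • x₀)] at h1 h2
  simp only [gromovProduct, dist_smul]
  linarith

/-- The action of an isometry group of `X` on the boundary: `g` maps the class of `(x_n)` to the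
class of `(g x_n)`. -/
instance : MulAction G (GromovBoundary x₀) where
  smul g := Quot.map (fun x => ⟨fun n => g • x.1 n, x.2.smul g⟩) fun _ _ h => h.smul g
  one_smul := by
    rintro ⟨x⟩
    exact congrArg (Quot.mk _) (Subtype.ext (funext fun n => one_smul G (x.1 n)))
  mul_smul := by
    rintro g h ⟨x⟩
    exact congrArg (Quot.mk _) (Subtype.ext (funext fun n => mul_smul g h (x.1 n)))

end Boundary

section Entropy

variable {G : Type*} [Group G]

/-- The maximal number `N(n, ε)` of pairwise `(n, ε)`-separated points: `x` and `y` are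
`(n, ε)`-separated if `d(gx, gy) ≥ ε` for some `g ∈ B(n)`. -/
def sepNumber (S : SymGenSet G) {Y : Type*} [MulAction G Y] (d : Y → Y → ℝ≥0∞) (n : ℕ) (ε : ℝ) :
    ℝ≥0∞ :=
  ⨆ (A : Finset Y) (_ : ∀ x ∈ A, ∀ y ∈ A, x ≠ y →
    ∃ g ∈ S.ball n, ENNReal.ofReal ε ≤ d (g • x) (g • y)), (A.card : ℝ≥0∞)

/-- The topological entropy of an action of `G` with respect to `S`, that is,
`lim_{ε → 0} limsup_n (1/n) log N(n, ε)`; the limit is a supremum because `N(n, ε)` does not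
decrease when `ε` does. -/
def actionEntropy (S : SymGenSet G) {Y : Type*} [MulAction G Y] (d : Y → Y → ℝ≥0∞) : EReal :=
  ⨆ (ε : ℝ) (_ : 0 < ε), limsup (fun n : ℕ => ENNReal.log (sepNumber S d n ε) / (n : EReal)) atTop

/-- The boundary of the Cayley graph `C(G, T)`, based at the identity. -/
abbrev groupBoundary (T : SymGenSet G) : Type _ := GromovBoundary (CayleyGraph.vertex T 1)

/-- The boundary entropy with respect to `S` of `G` acting on the boundary of `C(G, T)` equipped
with `d_η`. -/
def boundaryEntropy (S T : SymGenSet G) (η : ℝ) : EReal :=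
  actionEntropy S (boundaryDist η : groupBoundary T → groupBoundary T → ℝ≥0∞)

/-- The minimal boundary entropy of `G`, the infimum over all `S` of the boundary entropy with
respect to `S`. The boundary used for `S` is that of the Cayley graph of `T S` with the distance
`d_η`, where `η = η S`. -/
def minBoundaryEntropy (T : SymGenSet G → SymGenSet G) (η : SymGenSet G → ℝ) : EReal :=
  ⨅ S : SymGenSet G, boundaryEntropy S (T S) (η S)

end Entropy

section Growth

variable {G : Type*} [Group G]

/-- The exponential rate of growth `lim (1/n) log #B(n)` of `G` with respect to `S` (the limit
exists by subadditivity). -/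
def growthRate (S : SymGenSet G) : EReal :=
  limsup (fun n : ℕ => ENNReal.log ((S.ball n).encard : ℝ≥0∞) / (n : EReal)) atTop

/-- The minimal rate of growth of `G`. -/
def minGrowthRate (G : Type*) [Group G] : EReal := ⨅ S : SymGenSet G, growthRate S

/-- `(x_0, …, x_n)` is a sequence with `x_0 = 1`, `x_n = a`, `x_j ∈ S(jm)` for all `j`, and
`d(x_j, x_{j+1}) ≤ m + λε` for all `j`. -/
structure IsRelChain (S : SymGenSet G) (m : ℕ) (ε lam : ℝ) (n : ℕ) (a : G) (x : ℕ → G) : Prop where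
  zero : x 0 = 1
  last : x n = a
  mem_sphere : ∀ j ≤ n, x j ∈ S.sphere (j * m)
  step : ∀ j < n, S.wdist (x j) (x (j + 1)) ≤ m + lam * ε

/-- `A ⊆ S(mn)`, and any `x, y ∈ A` are joined to the identity by sequences `(x_0, …, x_n)` and
`(y_0, …, y_n)` as above such that `d(x_{k+1}, y_{k+1}) ≥ ε` when `k` is the maximal index with
`x_k = y_k` (a void condition if `k = n`). -/
def IsRelSeparated (S : SymGenSet G) (m : ℕ) (ε lam : ℝ) (n : ℕ) (A : Finset G) : Prop :=
  (A : Set G) ⊆ S.sphere (m * n) ∧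
  ∀ a ∈ A, ∀ b ∈ A, ∃ x y : ℕ → G,
    IsRelChain S m ε lam n a x ∧ IsRelChain S m ε lam n b y ∧
    ∀ k < n, x k = y k → (∀ j, k < j → j ≤ n → x j ≠ y j) →
      ε ≤ S.wdist (x (k + 1)) (y (k + 1))

/-- The maximal cardinality `N_0(n; m, ε, λ)` of a set `A` as above. -/
def relNumber (S : SymGenSet G) (m : ℕ) (ε lam : ℝ) (n : ℕ) : ℝ≥0∞ :=
  ⨆ (A : Finset G) (_ : IsRelSeparated S m ε lam n A), (A.card : ℝ≥0∞)

/-- The rate of growth `limsup (1/(mn)) log N_0(n; m, ε, λ)` relative to `m`, `ε`, `λ`. -/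
def relGrowthRate (S : SymGenSet G) (m : ℕ) (ε lam : ℝ) : EReal :=
  limsup (fun n : ℕ => ENNReal.log (relNumber S m ε lam n) / ((m * n : ℕ) : EReal)) atTop

/-- The rate of growth relative to the functions `μ` and `τ`: the supremum of the rates relative to
`m`, `ε`, `λ` with `λ ∈ (0, 1)`, `ε > τ(λ)`, `m > μ(λ, ε)`. -/
def relGrowthRateFun (S : SymGenSet G) (μ : ℝ → ℝ → ℕ) (τ : ℝ → ℝ≥0) : EReal :=
  ⨆ (m : ℕ) (ε : ℝ) (lam : ℝ) (_ : (0 < lam ∧ lam < 1) ∧ (τ lam : ℝ) < ε ∧ μ lam ε < m),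
    relGrowthRate S m ε lam

/-- The minimal relative rate of growth, the infimum over all `S` of the rate of growth relative to
bounds `μ` and `τ` given for each `S`. -/
def minRelGrowthRate (μ : SymGenSet G → ℝ → ℝ → ℕ) (τ : SymGenSet G → ℝ → ℝ≥0) : EReal :=
  ⨅ S : SymGenSet G, relGrowthRateFun S (μ S) (τ S)

end Growth

end

/-! All three invariants are bounded above through the standard generators and bounded below, for
every `S`, by the same count of reduced words.

The key fact is that every generating set of `F_k` contains `k` elements that freely generate a free
subgroup (`exists_free_family_of_closure_eq_top`). Choose them to be a basis of the abelianization
mod 2. By a Burnside basis argument their images generate every finite 2-group quotient of `F_k`.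
Hence for a finite 2-group `P`, restriction to these elements is an injective self-map of the finite
set `P^k = Hom(F_k, P)`, so it is bijective. A relation among the elements would then be killed by
every homomorphism `F_k → P`, which is impossible because free groups are residually finite
2-groups. It follows that `#B(n) ≥ (2k-1)^n` for every `S` (`pow_le_ncard_ball`), and
submultiplicativity of spheres gives the same bound for `#S(n)`.

Relative growth: colour group elements so that distinct close points get different colours, and sort
a sphere by the colour words of geodesic chains. A largest class is relatively separated, and the
loss `log K / m` in the rate tends to `0` because the number `K` of colours depends only on `ε`.

Boundary entropy: Gromov products in any Cayley graph of `F_k` agree, up to multiplicative and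
additive constants, with common prefix lengths of reduced words (`exists_isPrefixComparable`).
Boundary points thus have prefixes of every length, and `d_η` is controlled by them. Prefixes of
length `n + R` bound the number of separated points from above. From below, elements of a ball of
equal tree length are extended to rays, and the inverse of the branch point of two rays separates
them at a fixed scale. -/

noncomputable section

/-! ### Free groups are residually finite 2-groups: a ping-pong embedding into integral matrices,
reduced mod powers of 2. -/

section ResiduallyTwo

open Matrix

/-- The unipotent integral `2 × 2` matrix fixing the vector `(i, 1)` and congruent to `1` mod `8`. -/
def parabolicMatrix (i : ℕ) : (Matrix (Fin 2) (Fin 2) ℤ)ˣ where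
  val := !![1 + 8 * i, -8 * i ^ 2; 8, 1 - 8 * i]
  inv := !![1 - 8 * i, 8 * i ^ 2; -8, 1 + 8 * i]
  val_inv := by
    ext a b; fin_cases a <;> fin_cases b <;> simp [Matrix.mul_apply, Fin.sum_univ_two] <;> ring
  inv_val := by
    ext a b; fin_cases a <;> fin_cases b <;> simp [Matrix.mul_apply, Fin.sum_univ_two] <;> ring

/-- The action of invertible integral matrices on nonzero vectors. -/
instance matrixUnitsActionNonzero :
    MulAction (Matrix (Fin 2) (Fin 2) ℤ)ˣ {u : Fin 2 → ℤ // u ≠ 0} where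
  smul A u := ⟨(A : Matrix (Fin 2) (Fin 2) ℤ) *ᵥ u.1, fun h => u.2 <| by
    have := congrArg (fun v => (↑A⁻¹ : Matrix (Fin 2) (Fin 2) ℤ) *ᵥ v) h
    simpa only [Matrix.mulVec_mulVec, Units.inv_mul, Matrix.one_mulVec, Matrix.mulVec_zero] using this⟩
  one_smul u := Subtype.ext (by change (1 : Matrix (Fin 2) (Fin 2) ℤ) *ᵥ u.1 = u.1; simp)
  mul_smul A B u := Subtype.ext (by
    change ((A * B : (Matrix (Fin 2) (Fin 2) ℤ)ˣ) : Matrix (Fin 2) (Fin 2) ℤ) *ᵥ u.1 =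
      (A : Matrix (Fin 2) (Fin 2) ℤ) *ᵥ ((B : Matrix (Fin 2) (Fin 2) ℤ) *ᵥ u.1)
    rw [Units.val_mul, Matrix.mulVec_mulVec])

theorem parabolicMatrix_smul_zero (i : ℕ) (u : {u : Fin 2 → ℤ // u ≠ 0}) :
    (parabolicMatrix i • u).1 0 = u.1 0 + 8 * (u.1 0 - i * u.1 1) * i := by
  change ((parabolicMatrix i : Matrix (Fin 2) (Fin 2) ℤ) *ᵥ u.1) 0 = _
  simp [parabolicMatrix, Matrix.mulVec, dotProduct, Fin.sum_univ_two]; ring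

theorem parabolicMatrix_smul_one (i : ℕ) (u : {u : Fin 2 → ℤ // u ≠ 0}) :
    (parabolicMatrix i • u).1 1 = u.1 1 + 8 * (u.1 0 - i * u.1 1) := by
  change ((parabolicMatrix i : Matrix (Fin 2) (Fin 2) ℤ) *ᵥ u.1) 1 = _
  simp [parabolicMatrix, Matrix.mulVec, dotProduct, Fin.sum_univ_two]; ring

theorem parabolicMatrix_inv_smul_zero (i : ℕ) (u : {u : Fin 2 → ℤ // u ≠ 0}) :
    ((parabolicMatrix i)⁻¹ • u).1 0 = u.1 0 - 8 * (u.1 0 - i * u.1 1) * i := by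
  change ((↑(parabolicMatrix i)⁻¹ : Matrix (Fin 2) (Fin 2) ℤ) *ᵥ u.1) 0 = _
  simp [parabolicMatrix, Matrix.mulVec, dotProduct, Fin.sum_univ_two]; ring

theorem parabolicMatrix_inv_smul_one (i : ℕ) (u : {u : Fin 2 → ℤ // u ≠ 0}) :
    ((parabolicMatrix i)⁻¹ • u).1 1 = u.1 1 - 8 * (u.1 0 - i * u.1 1) := by
  change ((↑(parabolicMatrix i)⁻¹ : Matrix (Fin 2) (Fin 2) ℤ) *ᵥ u.1) 1 = _
  simp [parabolicMatrix, Matrix.mulVec, dotProduct, Fin.sum_univ_two]; ring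

/-- Each hypothesis confines `(x, y)` to the cone `|x - i y| ≤ |y| / 4` about the line of slope `x /
y = i`. Distinct integers are at distance at least 1, so two such cones meet only at the origin. -/
theorem eq_zero_of_parabolic_cones {i j : ℕ} (hij : i ≠ j) {x y : ℤ}
    (hi : 8 * (x - i * y) ^ 2 ≤ 2 * |y * (x - i * y)|)
    (hj : 8 * (x - j * y) ^ 2 ≤ 2 * |y * (x - j * y)|) : x = 0 ∧ y = 0 := by
  have key : ∀ b : ℤ, 8 * b ^ 2 ≤ 2 * |y * b| → 4 * |b| ≤ |y| := by
    intro b hb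
    rcases eq_or_ne b 0 with rfl | h
    · simp
    · rw [abs_mul, ← sq_abs] at hb
      have : 0 < |b| := abs_pos.2 h
      nlinarith
  have h1 := key _ hi
  have h2 := key _ hj
  have h3 : |y| ≤ |(j - i : ℤ) * y| := by
    rw [abs_mul]
    have : 1 ≤ |(j - i : ℤ)| := Int.one_le_abs (by omega)
    nlinarith [abs_nonneg y]
  have h4 : |(j - i : ℤ) * y| ≤ |x - i * y| + |x - j * y| := by
    have := abs_sub (x - i * y) (x - j * y)
    rwa [show x - i * y - (x - j * y) = (j - i : ℤ) * y by ring] at this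
  have h5 : |y| = 0 := by linarith [abs_nonneg y]
  have h6 : y = 0 := abs_eq_zero.1 h5
  subst h6
  have h7 : 4 * |x| ≤ 0 := by simpa using h1
  exact ⟨abs_nonpos_iff.1 (by linarith), rfl⟩

-- Ping-pong on nonzero vectors. The `i`-th matrix preserves the form `b = x - i y` and adds `8 b`
-- to `y`, so it shifts `2 y b` by `16 b²`. The thresholds `±8 b²` are half this shift, so the
-- complement of one cone goes exactly into the other.
open scoped Pointwise Function in
theorem lift_parabolicMatrix_injective : Function.Injective (FreeGroup.lift parabolicMatrix) := by
  let b : ℕ → {u : Fin 2 → ℤ // u ≠ 0} → ℤ := fun i u => u.1 0 - i * u.1 1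
  -- The weak inequality here and the strict one in `Y` put the fixed vector `(i, 1)`, where `b =
  -- 0`, into `X i` only.
  let X : ℕ → Set {u : Fin 2 → ℤ // u ≠ 0} := fun i => {u | 8 * b i u ^ 2 ≤ 2 * (u.1 1 * b i u)}
  let Y : ℕ → Set {u : Fin 2 → ℤ // u ≠ 0} := fun i => {u | 2 * (u.1 1 * b i u) < - 8 * b i u ^ 2}
  have hXY : ∀ i u, u ∈ X i ∨ u ∈ Y i → 8 * b i u ^ 2 ≤ 2 * |u.1 1 * b i u| := by
    rintro i u (h | h)
    · exact h.trans (by gcongr; exact le_abs_self _)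
    · have h' : 2 * (u.1 1 * b i u) < - 8 * b i u ^ 2 := h
      have := neg_abs_le (u.1 1 * b i u)
      linarith
  have hdisj : ∀ i j u, i ≠ j → (u ∈ X i ∨ u ∈ Y i) → (u ∈ X j ∨ u ∈ Y j) → False := by
    intro i j u hij h h'
    obtain ⟨h0, h1⟩ := eq_zero_of_parabolic_cones hij (hXY i u h) (hXY j u h')
    exact u.2 (funext fun a => by fin_cases a <;> assumption)
  refine FreeGroup.injective_lift_of_ping_pong parabolicMatrix X Y ?_ ?_ ?_ ?_ ?_ ?_
  · intro i
    refine ⟨⟨![i, 1], fun h => ?_⟩, ?_⟩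
    · simpa using congrFun h 1
    · simp [X, b]
  · exact fun i j hij => Set.disjoint_left.2 fun u h h' => hdisj i j u hij (.inl h) (.inl h')
  · exact fun i j hij => Set.disjoint_left.2 fun u h h' => hdisj i j u hij (.inr h) (.inr h')
  · intro i j
    refine Set.disjoint_left.2 fun u h h' => ?_
    rcases eq_or_ne i j with rfl | hij
    · have h1 : 8 * b i u ^ 2 ≤ 2 * (u.1 1 * b i u) := h
      have h2 : 2 * (u.1 1 * b i u) < - 8 * b i u ^ 2 := h'
      nlinarith [sq_nonneg (b i u)]
    · exact hdisj i j u hij (.inl h) (.inr h')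
  · rintro i _ ⟨u, hu, rfl⟩
    have hu' : ¬ (2 * (u.1 1 * b i u) < - 8 * b i u ^ 2) := hu
    change 8 * b i (parabolicMatrix i • u) ^ 2 ≤
      2 * ((parabolicMatrix i • u).1 1 * b i (parabolicMatrix i • u))
    simp only [b] at hu' ⊢
    rw [parabolicMatrix_smul_one, parabolicMatrix_smul_zero]
    linarith
  · rintro i _ ⟨u, hu, rfl⟩
    have hu' : ¬ (8 * b i u ^ 2 ≤ 2 * (u.1 1 * b i u)) := hu
    change 2 * (((parabolicMatrix i)⁻¹ • u).1 1 * b i ((parabolicMatrix i)⁻¹ • u)) <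
      - 8 * b i ((parabolicMatrix i)⁻¹ • u) ^ 2
    simp only [b] at hu' ⊢
    rw [parabolicMatrix_inv_smul_one, parabolicMatrix_inv_smul_zero]
    linarith

theorem exists_subgroup_units_one_add_two_mul {R : Type*} [Ring R] :
    ∃ H : Subgroup Rˣ, ∀ u : Rˣ, u ∈ H ↔ ∃ x : R, (u : R) = 1 + 2 * x := by
  refine ⟨{ carrier := {u | ∃ x : R, (u : R) = 1 + 2 * x}, mul_mem' := ?_, one_mem' := ⟨0, by simp⟩,
            inv_mem' := ?_ }, fun u => Iff.rfl⟩
  · rintro u v ⟨x, hx⟩ ⟨y, hy⟩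
    refine ⟨x + y + 2 * (x * y), ?_⟩
    rw [Units.val_mul, hx, hy]
    noncomm_ring
  · rintro u ⟨x, hx⟩
    refine ⟨-((↑u⁻¹ : R) * x), ?_⟩
    have h : (↑u⁻¹ : R) * (1 + 2 * x) = 1 := by rw [← hx, Units.inv_mul]
    have h2 : (↑u⁻¹ : R) * (2 * x) = 2 * (↑u⁻¹ * x) := by
      rw [← mul_assoc, ← mul_assoc, (Commute.ofNat_right (↑u⁻¹ : R) 2).eq]
    rw [mul_add, mul_one, h2] at h
    rw [mul_neg, ← sub_eq_add_neg, ← h, add_sub_cancel_right]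

/-- Squaring `1 + 2^(n+1) x` gives `1 + 2^(n+2) (x + 2^n x²)`. Reduced mod `2^n`, the congruence
subgroup of level 2 therefore has exponent dividing `2^n`. -/
theorem pow_two_pow_eq_one_add {R : Type*} [Ring R] {u : R} (hu : ∃ x, u = 1 + 2 * x) (n : ℕ) :
    ∃ x, u ^ 2 ^ n = 1 + 2 ^ (n + 1) * x := by
  induction n with
  | zero => simpa using hu
  | succ n ih =>
    obtain ⟨x, hx⟩ := ih
    refine ⟨x + 2 ^ n * x * x, ?_⟩
    have hc : x * (2 ^ (n + 1) : R) = 2 ^ (n + 1) * x :=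
      ((Commute.ofNat_right x 2).pow_right _).eq
    rw [pow_succ 2 n, pow_mul, hx, sq]
    calc (1 + 2 ^ (n + 1) * x) * (1 + 2 ^ (n + 1) * x)
        = 1 + 2 ^ (n + 1) * x + 2 ^ (n + 1) * x + 2 ^ (n + 1) * (x * 2 ^ (n + 1)) * x := by
          noncomm_ring
      _ = 1 + 2 ^ (n + 1 + 1) * (x + 2 ^ n * x * x) := by rw [hc]; noncomm_ring

/-- Free groups on countably many generators are residually finite 2-groups. -/
theorem freeGroup_nat_residually_two {w : FreeGroup ℕ} (hw : w ≠ 1) :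
    ∃ (P : Type) (_ : Group P) (_ : Finite P) (ψ : FreeGroup ℕ →* P), IsPGroup 2 P ∧ ψ w ≠ 1 := by
  set A := FreeGroup.lift parabolicMatrix w with hA
  have hA1 : (A : Matrix (Fin 2) (Fin 2) ℤ) ≠ 1 := fun h =>
    hw (lift_parabolicMatrix_injective (by rw [map_one]; exact Units.ext h))
  obtain ⟨a, b, hab⟩ : ∃ a b, (A : Matrix (Fin 2) (Fin 2) ℤ) a b ≠ (1 : Matrix (Fin 2) (Fin 2) ℤ) a b := by
    by_contra! h
    exact hA1 (Matrix.ext h)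
  -- A nonzero entry of `A - 1` smaller than `2^n` in absolute value survives reduction mod `2^n`.
  obtain ⟨n, hn⟩ : ∃ n : ℕ, |(A : Matrix (Fin 2) (Fin 2) ℤ) a b - (1 : Matrix (Fin 2) (Fin 2) ℤ) a b| < 2 ^ n := by
    obtain ⟨n, hn⟩ := pow_unbounded_of_one_lt
      (|(A : Matrix (Fin 2) (Fin 2) ℤ) a b - (1 : Matrix (Fin 2) (Fin 2) ℤ) a b|) (one_lt_two : (1 : ℤ) < 2)
    exact ⟨n, hn⟩
  have : NeZero (2 ^ n) := ⟨by positivity⟩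
  let red : Matrix (Fin 2) (Fin 2) ℤ →+* Matrix (Fin 2) (Fin 2) (ZMod (2 ^ n)) :=
    (Int.castRingHom (ZMod (2 ^ n))).mapMatrix
  let ψ : FreeGroup ℕ →* (Matrix (Fin 2) (Fin 2) (ZMod (2 ^ n)))ˣ :=
    (Units.map (red : _ →* _)).comp (FreeGroup.lift parabolicMatrix)
  obtain ⟨H, hH⟩ := exists_subgroup_units_one_add_two_mul (R := Matrix (Fin 2) (Fin 2) ℤ)
  have hmem : ∀ v, FreeGroup.lift parabolicMatrix v ∈ H := by
    intro v
    have : (FreeGroup.lift parabolicMatrix).range ≤ H := by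
      rw [FreeGroup.range_lift_eq_closure, Subgroup.closure_le]
      rintro _ ⟨i, rfl⟩
      refine (hH _).2 ⟨!![4 * i, -4 * i ^ 2; 4, -4 * i], ?_⟩
      rw [two_mul]
      ext c d
      fin_cases c <;> fin_cases d <;> simp [parabolicMatrix] <;> ring
    exact this ⟨v, rfl⟩
  have hpow : ∀ v, ψ v ^ 2 ^ n = 1 := by
    intro v
    obtain ⟨x, hx⟩ := pow_two_pow_eq_one_add ((hH _).1 (hmem v)) n
    have h2 : (2 : Matrix (Fin 2) (Fin 2) (ZMod (2 ^ n))) ^ n = 0 := by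
      have : ((2 ^ n : ℕ) : Matrix (Fin 2) (Fin 2) (ZMod (2 ^ n))) = 0 := by
        rw [← map_natCast (algebraMap (ZMod (2 ^ n)) (Matrix (Fin 2) (Fin 2) (ZMod (2 ^ n)))),
          ZMod.natCast_self, map_zero]
      rwa [Nat.cast_pow, Nat.cast_ofNat] at this
    refine Units.ext ?_
    have : red ((FreeGroup.lift parabolicMatrix v : Matrix (Fin 2) (Fin 2) ℤ) ^ 2 ^ n) = 1 := by
      rw [hx, map_add, map_one, map_mul, map_pow, map_ofNat, pow_succ, h2]
      simp
    rw [map_pow] at this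
    exact this
  refine ⟨ψ.range, inferInstance, inferInstance, ψ.rangeRestrict, ?_, ?_⟩
  · rintro ⟨_, v, rfl⟩
    exact ⟨n, Subtype.ext (hpow v)⟩
  · intro h
    have h1 : ψ w = 1 := congrArg Subtype.val h
    have h2 : red (A : Matrix (Fin 2) (Fin 2) ℤ) = 1 := congrArg Units.val h1
    have h3 : (((A : Matrix (Fin 2) (Fin 2) ℤ) a b - (1 : Matrix (Fin 2) (Fin 2) ℤ) a b : ℤ) : ZMod (2 ^ n)) = 0 := by
      have h4 := congrFun (congrFun h2 a) b
      have h5 := congrFun (congrFun (map_one red) a) b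
      rw [Int.cast_sub, sub_eq_zero]
      exact h4.trans h5.symm
    rw [ZMod.intCast_zmod_eq_zero_iff_dvd] at h3
    push_cast at h3
    exact hab (sub_eq_zero.1 (Int.eq_zero_of_abs_lt_dvd h3 hn))

theorem freeGroup_residually_two {k : ℕ} {w : FreeGroup (Fin k)} (hw : w ≠ 1) :
    ∃ (P : Type) (_ : Group P) (_ : Finite P) (ψ : FreeGroup (Fin k) →* P),
      IsPGroup 2 P ∧ ψ w ≠ 1 := by
  have hinj : Function.Injective (FreeGroup.map (Fin.val : Fin k → ℕ)) :=
    FreeGroup.map_injective Fin.val_injective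
  obtain ⟨P, _, _, ψ, hP, hψ⟩ := freeGroup_nat_residually_two
    (w := FreeGroup.map Fin.val w) (fun h => hw (hinj (by rw [h, map_one])))
  exact ⟨P, _, ‹_›, ψ.comp (FreeGroup.map Fin.val), hP, hψ⟩

end ResiduallyTwo

/-! ### The Burnside basis argument: a basis mod 2 generates a free subgroup. -/

section Frattini

variable {k : ℕ}

/-- The abelianization mod 2 of the free group. -/
def modTwo (k : ℕ) : FreeGroup (Fin k) →* Multiplicative (Fin k → ZMod 2) :=
  FreeGroup.lift fun i => Multiplicative.ofAdd (Pi.single i 1)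

theorem span_modTwo_eq_top {A : Set (FreeGroup (Fin k))} (hA : Subgroup.closure A = ⊤) :
    Submodule.span (ZMod 2) ((fun g => (modTwo k g).toAdd) '' A) = ⊤ := by
  have h1 : ∀ g : FreeGroup (Fin k),
      (modTwo k g).toAdd ∈ Submodule.span (ZMod 2) ((fun g => (modTwo k g).toAdd) '' A) := by
    intro g
    have hg : g ∈ Subgroup.closure A := hA ▸ Subgroup.mem_top g
    induction hg using Subgroup.closure_induction with
    | mem x hx => exact Submodule.subset_span ⟨x, hx, rfl⟩
    | one => simp
    | mul x y _ _ hx hy => rw [map_mul]; exact Submodule.add_mem _ hx hy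
    | inv x _ hx => rw [map_inv]; exact Submodule.neg_mem _ hx
  rw [eq_top_iff, ← (Pi.basisFun (ZMod 2) (Fin k)).span_eq, Submodule.span_le]
  rintro _ ⟨i, rfl⟩
  have := h1 (FreeGroup.of i)
  simpa [modTwo] using this

/-- A homomorphism to a group of exponent two that kills a spanning set mod 2 is trivial. -/
theorem hom_eq_one_of_modTwo_span {A : Type*} [CommGroup A] (h2 : ∀ a : A, a ^ 2 = 1)
    (χ : FreeGroup (Fin k) →* A) {s : Fin k → FreeGroup (Fin k)}
    (hs : Submodule.span (ZMod 2) (Set.range fun i => (modTwo k (s i)).toAdd) = ⊤)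
    (hχ : ∀ i, χ (s i) = 1) : χ = 1 := by
  -- Exponent two makes `A` a vector space over the field with two elements, and `χ` factors through
  -- `modTwo` as a linear map, which vanishes on a spanning set.
  let : Module (ZMod 2) (Additive A) := AddCommGroup.zmodModule (n := 2) fun a => h2 a.toMul
  let L : (Fin k → ZMod 2) →ₗ[ZMod 2] Additive A :=
    (Pi.basisFun (ZMod 2) (Fin k)).constr (ZMod 2) fun i => Additive.ofMul (χ (FreeGroup.of i))
  have hL : (AddMonoidHom.toMultiplicativeLeft L.toAddMonoidHom).comp (modTwo k) = χ := by
    ext i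
    have := (Pi.basisFun (ZMod 2) (Fin k)).constr_basis (ZMod 2)
      (fun i => Additive.ofMul (χ (FreeGroup.of i))) i
    rw [Pi.basisFun_apply] at this
    simp only [modTwo, MonoidHom.comp_apply, FreeGroup.lift_apply_of]
    exact congrArg Additive.toMul this
  have hL0 : L = 0 := by
    refine LinearMap.ext_on_range hs fun i => ?_
    have := DFunLike.congr_fun hL (s i)
    rw [hχ i] at this
    exact congrArg Additive.ofMul this
  ext i
  rw [← hL, hL0]
  rfl

/-- The centre of a nontrivial finite 2-group is nontrivial, so by simplicity it is everything; a
simple abelian group has prime order, here 2. -/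
theorem isPGroup_two_commGroup_of_simple {Q : Type*} [Group Q] [Finite Q] (hQ : IsPGroup 2 Q)
    [IsSimpleGroup Q] : (∀ a b : Q, a * b = b * a) ∧ ∀ a : Q, a ^ 2 = 1 := by
  have hc : ∀ a b : Q, a * b = b * a := by
    have hn := hQ.center_nontrivial
    rcases (inferInstance : (Subgroup.center Q).Normal).eq_bot_or_eq_top with h | h
    · rw [h] at hn
      exact absurd hn (not_nontrivial _)
    · intro a b
      exact (Subgroup.mem_center_iff.1 (h ▸ Subgroup.mem_top b) a)
  refine ⟨hc, ?_⟩
  let : CommGroup Q := { ‹Group Q› with mul_comm := hc }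
  have hp : (Nat.card Q).Prime := IsSimpleGroup.prime_card
  obtain ⟨n, hn⟩ := IsPGroup.iff_card.1 hQ
  have : Nat.card Q = 2 := by
    rw [hn] at hp ⊢
    rw [hp.eq_one_of_pow, pow_one]
  intro a
  rw [← this]
  exact pow_card_eq_one'

/-- Elements that span mod 2 generate every finite 2-group quotient. -/
theorem eq_top_of_modTwo_span {Q : Type*} [Group Q] [Finite Q] (hQ : IsPGroup 2 Q)
    {ψ : FreeGroup (Fin k) →* Q} (hψ : Function.Surjective ψ) {s : Fin k → FreeGroup (Fin k)}
    (hs : Submodule.span (ZMod 2) (Set.range fun i => (modTwo k (s i)).toAdd) = ⊤)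
    {D : Subgroup Q} (hD : ∀ i, ψ (s i) ∈ D) : D = ⊤ := by
  -- A proper `D` lies in a maximal subgroup `M`. In a nilpotent group `M` is normal, and the simple
  -- quotient has exponent two, so the map to it is trivial as soon as it kills the `s i`. This
  -- contradicts surjectivity.
  by_contra hne
  obtain ⟨M, hM, hDM⟩ := (eq_top_or_exists_le_coatom D).resolve_left hne
  have hnil : Group.IsNilpotent Q := hQ.isNilpotent
  have hnorm : M.Normal :=
    Subgroup.NormalizerCondition.normal_of_coatom M Group.normalizerCondition_of_isNilpotent hM
  have hsimple : IsSimpleGroup (Q ⧸ M) := by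
    have : Nontrivial (Q ⧸ M) := QuotientGroup.nontrivial_iff.2 hM.1
    refine ⟨fun H _ => ?_⟩
    have hle : M ≤ H.comap (QuotientGroup.mk' M) := by
      intro x hx
      rw [Subgroup.mem_comap, QuotientGroup.mk'_apply, (QuotientGroup.eq_one_iff x).2 hx]
      exact H.one_mem
    have hsurj := QuotientGroup.mk'_surjective M
    rcases hM.le_iff.1 hle with h | h
    · right
      rw [← Subgroup.map_comap_eq_self_of_surjective hsurj H, h,
        Subgroup.map_top_of_surjective _ hsurj]
    · left
      rw [← Subgroup.map_comap_eq_self_of_surjective hsurj H, h, QuotientGroup.map_mk'_self]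
  obtain ⟨hc, h2⟩ := isPGroup_two_commGroup_of_simple (hQ.to_quotient M)
  let : CommGroup (Q ⧸ M) := { (inferInstance : Group (Q ⧸ M)) with mul_comm := hc }
  have h1 : (QuotientGroup.mk' M).comp ψ = 1 :=
    hom_eq_one_of_modTwo_span h2 _ hs fun i => (QuotientGroup.eq_one_iff _).2 (hDM (hD i))
  refine hM.1 (eq_top_iff.2 fun q _ => ?_)
  obtain ⟨w, rfl⟩ := hψ q
  exact (QuotientGroup.eq_one_iff _).1 (DFunLike.congr_fun h1 w)

/-- Elements of a free group of rank `k` that form a basis mod 2 are free generators of the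
subgroup which they generate. -/
theorem lift_injective_of_modTwo_span {s : Fin k → FreeGroup (Fin k)}
    (hs : Submodule.span (ZMod 2) (Set.range fun i => (modTwo k (s i)).toAdd) = ⊤) :
    Function.Injective (FreeGroup.lift s) := by
  refine (injective_iff_map_eq_one _).2 fun w hw => ?_
  by_contra hne
  obtain ⟨P, _, _, ψ, hP, hψ⟩ := freeGroup_residually_two hne
  -- `Φ` is restriction of homomorphisms to the elements `s i`, with `Hom(F_k, P)` identified with
  -- `P^k`.
  let Φ : (Fin k → P) → (Fin k → P) := fun f i => FreeGroup.lift f (s i)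
  have hinj : Function.Injective Φ := by
    intro f f' hff
    let Ψ := (FreeGroup.lift f).prod (FreeGroup.lift f')
    have hPP : IsPGroup 2 (P × P) := by
      rintro ⟨a, b⟩
      obtain ⟨m, hm⟩ := hP a
      obtain ⟨n, hn⟩ := hP b
      refine ⟨m + n, Prod.ext ?_ ?_⟩
      · simp [pow_add, pow_mul, hm]
      · simp [pow_add, pow_mul', hn]
    -- The range of the joint map to `P × P` is a 2-group, generated by the images of the `s i`.
    -- These lie on the diagonal, hence so does the whole range.
    have htop := eq_top_of_modTwo_span (hPP.to_subgroup Ψ.range) Ψ.rangeRestrict_surjective hs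
      (D := ((MonoidHom.fst P P).comp Ψ.range.subtype).eqLocus
        ((MonoidHom.snd P P).comp Ψ.range.subtype)) fun i => congrFun hff i
    funext i
    have : Ψ.rangeRestrict (FreeGroup.of i) ∈ ((MonoidHom.fst P P).comp Ψ.range.subtype).eqLocus
        ((MonoidHom.snd P P).comp Ψ.range.subtype) := htop ▸ Subgroup.mem_top _
    have h3 : FreeGroup.lift f (FreeGroup.of i) = FreeGroup.lift f' (FreeGroup.of i) := this
    simpa using h3
  -- Finiteness turns injectivity of `Φ` into surjectivity, so `ψ` factors through `FreeGroup.lift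
  -- s` and must kill `w`.
  obtain ⟨f, hf⟩ := Finite.surjective_of_injective hinj fun i => ψ (FreeGroup.of i)
  have h4 : (FreeGroup.lift f).comp (FreeGroup.lift s) = ψ := by
    ext i
    simpa using congrFun hf i
  exact hψ (by rw [← h4, MonoidHom.comp_apply, hw, map_one])

/-- A generating set of a free group of rank `k` contains `k` elements that generate a free
subgroup of rank `k`. -/
theorem exists_free_family_of_closure_eq_top {A : Set (FreeGroup (Fin k))}
    (hA : Subgroup.closure A = ⊤) :
    ∃ s : Fin k → FreeGroup (Fin k), (∀ i, s i ∈ A) ∧ Function.Injective (FreeGroup.lift s) := by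
  have hspan := span_modTwo_eq_top hA
  -- A basis extracted from the spanning set; its size is the dimension `k`, and each vector is
  -- lifted back to `A`.
  obtain ⟨f, hf, hf', -⟩ := Submodule.exists_fun_fin_finrank_span_eq (ZMod 2)
    ((fun g => (modTwo k g).toAdd) '' A)
  have hk : Module.finrank (ZMod 2)
      (Submodule.span (ZMod 2) ((fun g => (modTwo k g).toAdd) '' A)) = k := by
    rw [hspan, finrank_top, Module.finrank_fin_fun]
  choose s hs using hf
  refine ⟨fun i => s (Fin.cast hk.symm i), fun i => (hs _).1, lift_injective_of_modTwo_span ?_⟩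
  refine Eq.trans ?_ (hf'.trans hspan)
  congr 1
  ext v
  constructor
  · rintro ⟨i, rfl⟩
    exact ⟨Fin.cast hk.symm i, (hs _).2.symm⟩
  · rintro ⟨i, rfl⟩
    exact ⟨Fin.cast hk i, (hs i).2⟩

end Frattini

/-! ### Tree geometry of the free group: common prefixes and branch points. -/

section CommonPrefix

/-- The length of the longest common prefix of two lists. -/
def commonPrefixLength {β : Type*} [DecidableEq β] : List β → List β → ℕ
  | a :: l, b :: m => if a = b then commonPrefixLength l m + 1 else 0
  | _, _ => 0

theorem le_commonPrefixLength_iff {β : Type*} [DecidableEq β] (n : ℕ) (l m : List β) :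
    n ≤ commonPrefixLength l m ↔ n ≤ l.length ∧ n ≤ m.length ∧ l.take n = m.take n := by
  induction l generalizing n m with
  | nil => cases m <;> simp [commonPrefixLength]; omega
  | cons a l ih =>
    cases m with
    | nil => simp [commonPrefixLength]; omega
    | cons b m =>
      cases n with
      | zero => simp
      | succ n =>
        rw [commonPrefixLength]
        split_ifs with h
        · simp [h, ih]
        · simp [h]

theorem exists_append_commonPrefixLength {β : Type*} [DecidableEq β] (l m : List β) :
    ∃ p a b : List β, l = p ++ a ∧ m = p ++ b ∧ p.length = commonPrefixLength l m ∧
      commonPrefixLength a b = 0 := by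
  induction l generalizing m with
  | nil => exact ⟨[], [], m, by cases m <;> simp [commonPrefixLength]⟩
  | cons a l ih =>
    cases m with
    | nil => exact ⟨[], a :: l, [], by simp [commonPrefixLength]⟩
    | cons b m =>
      by_cases h : a = b
      · obtain ⟨p, c, d, h1, h2, h3, h4⟩ := ih m
        exact ⟨a :: p, c, d, by simp [h1], by simp [h, h2], by simp [commonPrefixLength, h, h3], h4⟩
      · exact ⟨[], a :: l, b :: m, by simp [commonPrefixLength, h]⟩

namespace FreeGroup

variable {α : Type*} [DecidableEq α]

/-- The length of the common prefix of the reduced words of `x` and `y`; this is the Gromov product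
at `1` in the Cayley tree of the free group. -/
def commonPrefix (x y : FreeGroup α) : ℕ := commonPrefixLength x.toWord y.toWord

theorem le_commonPrefix_iff {n : ℕ} {x y : FreeGroup α} : n ≤ commonPrefix x y ↔
    n ≤ x.norm ∧ n ≤ y.norm ∧ x.toWord.take n = y.toWord.take n :=
  le_commonPrefixLength_iff _ _ _

theorem commonPrefix_comm (x y : FreeGroup α) : commonPrefix x y = commonPrefix y x :=
  eq_of_forall_le_iff fun n => by
    rw [le_commonPrefix_iff, le_commonPrefix_iff]; tauto

/-- The ultrametric inequality for Gromov products in a tree; it replaces hyperbolicity estimates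
throughout. -/
theorem min_commonPrefix_le (x y z : FreeGroup α) :
    min (commonPrefix x y) (commonPrefix y z) ≤ commonPrefix x z := by
  obtain ⟨h1, -, h2⟩ := le_commonPrefix_iff.1 (min_le_left (commonPrefix x y) (commonPrefix y z))
  obtain ⟨-, h3, h4⟩ := le_commonPrefix_iff.1 (min_le_right (commonPrefix x y) (commonPrefix y z))
  exact le_commonPrefix_iff.2 ⟨h1, h3, h2.trans h4⟩

theorem commonPrefix_self (x : FreeGroup α) : commonPrefix x x = x.norm :=
  eq_of_forall_le_iff fun n => by simp [le_commonPrefix_iff]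

theorem norm_mk_of_isReduced {L : List (α × Bool)} (h : IsReduced L) : (mk L).norm = L.length := by
  rw [norm, toWord_mk, h.reduce_eq]

/-- The last letter of `invRev a` is the inverse of the first letter of `a`, so cancellation at the
junction would require `a` and `b` to begin alike. -/
theorem isReduced_invRev_append {a b : List (α × Bool)} (ha : IsReduced a) (hb : IsReduced b)
    (hab : commonPrefixLength a b = 0) : IsReduced (invRev a ++ b) := by
  have ha' : IsReduced (invRev a) := by
    rw [isReduced_iff_reduce_eq, reduce_invRev, ha.reduce_eq]
  refine List.isChain_append.2 ⟨ha', hb, ?_⟩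
  intro x hx y hy hxy
  rcases a with _ | ⟨c, a⟩
  · simp at hx
  · rcases b with _ | ⟨d, b⟩
    · simp at hy
    · rw [commonPrefixLength] at hab
      have hcd : c ≠ d := by
        intro h
        simp [h] at hab
      simp [invRev] at hx hy
      subst hx hy
      rcases c with ⟨i, e⟩
      rcases d with ⟨j, f⟩
      simp only at hxy
      subst hxy
      cases e <;> cases f <;> simp_all

/-- The branch point of two elements: `x = u a`, `y = u b` without cancellation. -/
theorem exists_branch (x y : FreeGroup α) : ∃ u a b : FreeGroup α, x = u * a ∧ y = u * b ∧
    u.norm = commonPrefix x y ∧ x.norm = u.norm + a.norm ∧ y.norm = u.norm + b.norm ∧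
    (x⁻¹ * y).norm = a.norm + b.norm := by
  obtain ⟨p, a, b, h1, h2, h3, h4⟩ := exists_append_commonPrefixLength x.toWord y.toWord
  have hx : IsReduced (p ++ a) := h1 ▸ isReduced_toWord
  have hy : IsReduced (p ++ b) := h2 ▸ isReduced_toWord
  have hp : IsReduced p := hx.infix ⟨[], a, by simp⟩
  have ha : IsReduced a := hx.infix ⟨p, [], by simp⟩
  have hb : IsReduced b := hy.infix ⟨p, [], by simp⟩
  have hx' : x = mk p * mk a := by rw [mul_mk, ← h1, mk_toWord]
  have hy' : y = mk p * mk b := by rw [mul_mk, ← h2, mk_toWord]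
  have hxy : x⁻¹ * y = mk (invRev a ++ b) := by
    rw [← mul_mk, ← inv_mk, hx', hy']; group
  refine ⟨mk p, mk a, mk b, hx', hy', ?_, ?_, ?_, ?_⟩
  · rw [norm_mk_of_isReduced hp, h3, commonPrefix]
  · rw [norm_mk_of_isReduced hp, norm_mk_of_isReduced ha, norm, h1, List.length_append]
  · rw [norm_mk_of_isReduced hp, norm_mk_of_isReduced hb, norm, h2, List.length_append]
  · rw [hxy, norm_mk_of_isReduced (isReduced_invRev_append ha hb h4), List.length_append,
      invRev_length, norm_mk_of_isReduced ha, norm_mk_of_isReduced hb]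

theorem norm_inv_mul_add (x y : FreeGroup α) :
    (x⁻¹ * y).norm + 2 * commonPrefix x y = x.norm + y.norm := by
  obtain ⟨u, a, b, -, -, h1, h2, h3, h4⟩ := exists_branch x y
  omega

/-- The distance of `x` and `y` is invariant under left translation, and their norms change by at
most `g.norm`. -/
theorem commonPrefix_le_mul_left (g x y : FreeGroup α) :
    commonPrefix x y ≤ commonPrefix (g * x) (g * y) + g.norm := by
  have h1 := norm_inv_mul_add x y
  have h2 := norm_inv_mul_add (g * x) (g * y)
  have h3 := norm_mul_le g⁻¹ (g * x)
  have h4 := norm_mul_le g⁻¹ (g * y)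
  rw [inv_mul_cancel_left, norm_inv_eq] at h3 h4
  rw [show (g * x)⁻¹ * (g * y) = x⁻¹ * y by group] at h2
  omega

end FreeGroup

end CommonPrefix

/-! ### Counting reduced words. -/

section WordCount

variable {k : ℕ}

/-- The reduced words of length `n + 1` with first letter `a`. -/
def reducedWordsFrom : ℕ → Fin k × Bool → Finset (List (Fin k × Bool))
  | 0, a => {[a]}
  | n + 1, a => (Finset.univ.erase (a.1, !a.2)).biUnion fun b =>
      (reducedWordsFrom n b).map ⟨List.cons a, List.cons_injective⟩

theorem mem_reducedWordsFrom {n : ℕ} {a : Fin k × Bool} {l : List (Fin k × Bool)} :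
    l ∈ reducedWordsFrom n a ↔
      FreeGroup.IsReduced l ∧ l.length = n + 1 ∧ l.head? = some a := by
  induction n generalizing a l with
  | zero =>
    rw [reducedWordsFrom, Finset.mem_singleton]
    constructor
    · rintro rfl
      simp
    · rintro ⟨-, h2, h3⟩
      rcases l with _ | ⟨b, _ | ⟨c, l⟩⟩ <;> simp_all
  | succ n ih =>
    rw [reducedWordsFrom]
    simp only [Finset.mem_biUnion, Finset.mem_erase, Finset.mem_univ, and_true, Finset.mem_map,
      Function.Embedding.coeFn_mk, ih]
    have hne : ∀ b : Fin k × Bool, b ≠ (a.1, !a.2) ↔ (a.1 = b.1 → a.2 = b.2) := by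
      rintro ⟨j, f⟩
      rcases a with ⟨i, e⟩
      cases e <;> cases f <;> simp [eq_comm]
    constructor
    · rintro ⟨b, hb, m, ⟨h1, h2, h3⟩, rfl⟩
      rcases m with _ | ⟨c, m⟩
      · simp at h3
      · simp only [List.head?_cons, Option.some.injEq] at h3
        subst h3
        exact ⟨FreeGroup.isReduced_cons_cons.2 ⟨(hne _).1 hb, h1⟩, by simp [← h2], rfl⟩
    · rintro ⟨h1, h2, h3⟩
      rcases l with _ | ⟨b, _ | ⟨c, l⟩⟩
      · simp at h3
      · simp at h2
      · simp only [List.head?_cons, Option.some.injEq] at h3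
        subst h3
        obtain ⟨h4, h5⟩ := FreeGroup.isReduced_cons_cons.1 h1
        exact ⟨c, (hne c).2 h4, c :: l, ⟨h5, by simpa using h2, rfl⟩, rfl⟩

theorem card_reducedWordsFrom (n : ℕ) (a : Fin k × Bool) :
    (reducedWordsFrom n a).card = (2 * k - 1) ^ n := by
  induction n generalizing a with
  | zero => simp [reducedWordsFrom]
  | succ n ih =>
    rw [reducedWordsFrom, Finset.card_biUnion]
    · simp only [Finset.card_map, ih, Finset.sum_const, Finset.mem_univ, Finset.card_erase_of_mem,
        Finset.card_univ, Fintype.card_prod, Fintype.card_fin, Fintype.card_bool, smul_eq_mul]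
      rw [pow_succ', mul_comm k 2]
    · intro b _ c _ hbc
      rw [Function.onFun, Finset.disjoint_map, Finset.disjoint_left]
      intro l hl hl'
      have h1 := (mem_reducedWordsFrom.1 hl).2.2
      rw [(mem_reducedWordsFrom.1 hl').2.2] at h1
      exact hbc (Option.some.inj h1).symm

/-- The spheres of the Cayley tree of the free group of rank `k`. -/
theorem exists_finset_norm_eq (hk : 1 ≤ k) (n : ℕ) : ∃ s : Finset (FreeGroup (Fin k)),
    (∀ x, x ∈ s ↔ x.norm = n) ∧ (2 * k - 1) ^ n ≤ s.card ∧ s.card ≤ 2 * k * (2 * k - 1) ^ n := by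
  rcases n with _ | n
  · refine ⟨{1}, fun x => ?_, by simp, by simp; omega⟩
    rw [Finset.mem_singleton, FreeGroup.norm_eq_zero]
  · let W : Finset (List (Fin k × Bool)) := Finset.univ.biUnion (reducedWordsFrom n)
    have hW : ∀ l, l ∈ W ↔ FreeGroup.IsReduced l ∧ l.length = n + 1 := by
      intro l
      simp only [W, Finset.mem_biUnion, Finset.mem_univ, true_and, mem_reducedWordsFrom]
      constructor
      · rintro ⟨a, h1, h2, -⟩
        exact ⟨h1, h2⟩
      · rintro ⟨h1, h2⟩
        rcases l with _ | ⟨a, l⟩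
        · simp at h2
        · exact ⟨a, h1, h2, rfl⟩
    have hcard : W.card = 2 * k * (2 * k - 1) ^ n := by
      rw [Finset.card_biUnion]
      · simp only [card_reducedWordsFrom, Finset.sum_const, Finset.card_univ, Fintype.card_prod,
          Fintype.card_fin, Fintype.card_bool, smul_eq_mul]
        ring
      · intro b _ c _ hbc
        rw [Function.onFun, Finset.disjoint_left]
        intro l hl hl'
        have h1 := (mem_reducedWordsFrom.1 hl).2.2
        rw [(mem_reducedWordsFrom.1 hl').2.2] at h1
        exact hbc (Option.some.inj h1).symm
    have hinj : Set.InjOn (FreeGroup.mk (α := Fin k)) W := by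
      intro l hl m hm h
      have := congrArg FreeGroup.toWord h
      rwa [FreeGroup.toWord_mk, FreeGroup.toWord_mk, ((hW l).1 hl).1.reduce_eq,
        ((hW m).1 hm).1.reduce_eq] at this
    refine ⟨W.image FreeGroup.mk, fun x => ?_, ?_, ?_⟩
    · rw [Finset.mem_image]
      constructor
      · rintro ⟨l, hl, rfl⟩
        rw [FreeGroup.norm_mk_of_isReduced ((hW l).1 hl).1, ((hW l).1 hl).2]
      · intro hx
        exact ⟨x.toWord, (hW _).2 ⟨FreeGroup.isReduced_toWord, hx⟩, FreeGroup.mk_toWord⟩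
    · rw [Finset.card_image_of_injOn hinj, hcard, pow_succ']
      exact Nat.mul_le_mul_right _ (Nat.sub_le _ _)
    · rw [Finset.card_image_of_injOn hinj, hcard, pow_succ']
      exact Nat.mul_le_mul_left _ (Nat.le_mul_of_pos_left _ (by omega))

end WordCount

/-! ### Balls and spheres of a general group: finiteness and submultiplicativity. -/

namespace SymGenSet

variable {G : Type*} [Group G] (S : SymGenSet G)

theorem length_prod_le (l : List G) (hl : ∀ s ∈ l, s ∈ S.carrier) : S.length l.prod ≤ l.length :=
  Nat.sInf_le ⟨l, rfl, hl, rfl⟩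

theorem length_inv (g : G) : S.length g⁻¹ = S.length g :=
  le_antisymm (S.length_inv_le g) (by simpa using S.length_inv_le g⁻¹)

theorem length_le_one_of_mem {s : G} (hs : s ∈ S.carrier) : S.length s ≤ 1 := by
  simpa using S.length_prod_le [s] (by simpa using hs)

theorem length_eq_zero_iff {g : G} : S.length g = 0 ↔ g = 1 := by
  constructor
  · intro h
    obtain ⟨l, hl, -, rfl⟩ := S.isProdOf_length g
    rw [h, List.length_eq_zero_iff] at hl
    rw [hl, List.prod_nil]
  · rintro rfl
    exact S.length_one

/-- Geodesics can be cut. -/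
theorem exists_mul_of_length_eq_add {g : G} {a b : ℕ} (h : S.length g = a + b) :
    ∃ u v, g = u * v ∧ S.length u = a ∧ S.length v = b := by
  obtain ⟨l, hl, hl1, hl2⟩ := S.isProdOf_length g
  have h1 := S.length_prod_le (l.take a) fun s hs => hl1 s (List.mem_of_mem_take hs)
  have h2 := S.length_prod_le (l.drop a) fun s hs => hl1 s (List.mem_of_mem_drop hs)
  have h3 := S.length_mul_le (l.take a).prod (l.drop a).prod
  rw [List.prod_take_mul_prod_drop, hl2] at h3
  rw [List.length_take] at h1
  rw [List.length_drop] at h2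
  exact ⟨(l.take a).prod, (l.drop a).prod, by rw [List.prod_take_mul_prod_drop, hl2], by omega,
    by omega⟩

theorem finite_sphere (n : ℕ) : (S.sphere n).Finite := by
  induction n with
  | zero =>
    refine (Set.finite_singleton (1 : G)).subset fun g hg => ?_
    exact S.length_eq_zero_iff.1 hg
  | succ n ih =>
    refine (Set.Finite.image2 (· * ·) ih S.carrier.finite_toSet).subset fun g hg => ?_
    obtain ⟨u, v, rfl, hu, hv⟩ := S.exists_mul_of_length_eq_add hg
    refine ⟨u, hu, v, ?_, rfl⟩
    obtain ⟨l, hl, hl1, rfl⟩ := S.isProdOf_length v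
    rw [hv, List.length_eq_one_iff] at hl
    obtain ⟨s, rfl⟩ := hl
    simpa using hl1

theorem ball_eq_biUnion (n : ℕ) : S.ball n = ⋃ i ∈ Finset.range (n + 1), S.sphere i := by
  ext g
  simp [ball, sphere]

theorem finite_ball (n : ℕ) : (S.ball n).Finite := by
  rw [ball_eq_biUnion]
  exact Set.Finite.biUnion (Finset.finite_toSet _) fun i _ => S.finite_sphere i

theorem ncard_ball_le (n : ℕ) : (S.ball n).ncard ≤ ∑ i ∈ Finset.range (n + 1), (S.sphere i).ncard := by
  rw [ball_eq_biUnion]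
  exact Finset.set_ncard_biUnion_le _ _

theorem ncard_sphere_add_le (a b : ℕ) :
    (S.sphere (a + b)).ncard ≤ (S.sphere a).ncard * (S.sphere b).ncard := by
  rw [← Set.ncard_prod]
  have hfin := (S.finite_sphere a).prod (S.finite_sphere b)
  refine le_trans (Set.ncard_le_ncard (t := (fun p : G × G => p.1 * p.2) '' S.sphere a ×ˢ S.sphere b)
    ?_ (hfin.image _)) (Set.ncard_image_le hfin)
  intro g hg
  obtain ⟨u, v, rfl, hu, hv⟩ := S.exists_mul_of_length_eq_add hg
  exact ⟨(u, v), ⟨hu, hv⟩, rfl⟩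

theorem ncard_sphere_mul_add_le (N j r : ℕ) :
    (S.sphere (N * j + r)).ncard ≤ (S.sphere N).ncard ^ j * (S.sphere r).ncard := by
  induction j with
  | zero => simp
  | succ j ih =>
    calc (S.sphere (N * (j + 1) + r)).ncard = (S.sphere (N + (N * j + r))).ncard := by
          congr 2; ring
      _ ≤ _ := S.ncard_sphere_add_le _ _
      _ ≤ (S.sphere N).ncard * ((S.sphere N).ncard ^ j * (S.sphere r).ncard) :=
          Nat.mul_le_mul_left _ ih
      _ = _ := by ring

theorem sphere_nonempty [Infinite G] (n : ℕ) : (S.sphere n).Nonempty := by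
  by_contra h
  refine Set.infinite_univ ((S.finite_ball n).subset fun g _ => ?_)
  by_contra hg
  have hg' : n < S.length g := not_le.1 hg
  obtain ⟨u, v, -, hu, -⟩ := S.exists_mul_of_length_eq_add (a := n) (b := S.length g - n)
    (by omega : S.length g = _)
  exact h ⟨u, hu⟩

/-- Spheres are at least as large as an exponential lower bound for balls. -/
theorem pow_le_ncard_sphere [Infinite G] {q : ℕ} (hq : ∀ n, q ^ n ≤ (S.ball n).ncard) (N : ℕ) :
    q ^ N ≤ (S.sphere N).ncard := by
  have hne : ∀ n, 1 ≤ (S.sphere n).ncard := fun n =>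
    (Set.ncard_pos (S.finite_sphere n)).2 (S.sphere_nonempty n)
  rcases Nat.eq_zero_or_pos N with rfl | hN
  · simpa using hne 0
  -- If `M = #S(N)` were less than `q^N`, then `q^N ≥ M + 1`. Submultiplicativity bounds the ball of
  -- radius `N n` by a linear factor times `M^n`, which cannot stay above `(M + 1)^n`.
  by_contra! hlt
  set M := (S.sphere N).ncard with hM
  set B := (S.ball N).ncard with hB
  have hsph : ∀ n i, i ≤ N * n → (S.sphere i).ncard ≤ M ^ n * B := by
    intro n i hi
    have h1 := S.ncard_sphere_mul_add_le N (i / N) (i % N)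
    rw [Nat.div_add_mod] at h1
    have h2 : i / N ≤ n := by
      rw [Nat.div_le_iff_le_mul_add_pred hN]; omega
    have h3 : (S.sphere (i % N)).ncard ≤ B :=
      Set.ncard_le_ncard (fun g hg => le_trans (le_of_eq hg) (Nat.mod_lt i hN).le)
        (S.finite_ball N)
    exact h1.trans (Nat.mul_le_mul (Nat.pow_le_pow_right (hne N) h2) h3)
  have hball : ∀ n, (M + 1) ^ n ≤ (N * n + 1) * (M ^ n * B) := by
    intro n
    calc (M + 1) ^ n ≤ (q ^ N) ^ n := Nat.pow_le_pow_left hlt n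
      _ = q ^ (N * n) := (pow_mul q N n).symm
      _ ≤ (S.ball (N * n)).ncard := hq _
      _ ≤ _ := S.ncard_ball_le _
      _ ≤ ∑ i ∈ Finset.range (N * n + 1), M ^ n * B :=
          Finset.sum_le_sum fun i hi => hsph n i (by simpa [Nat.lt_succ_iff] using hi)
      _ = _ := by simp
  have hM0 : (0 : ℝ) < M := by exact_mod_cast hne N
  have hr : 1 < ((M : ℝ) + 1) / M := by rw [one_lt_div hM0]; linarith
  have hlim : Tendsto (fun n : ℕ => ((N : ℝ) * B) * ((n : ℝ) ^ 1 / (((M : ℝ) + 1) / M) ^ n) +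
      B * ((n : ℝ) ^ 0 / (((M : ℝ) + 1) / M) ^ n)) atTop (𝓝 ((N * B : ℝ) * 0 + B * 0)) :=
    ((tendsto_pow_const_div_const_pow_of_one_lt 1 hr).const_mul _).add
      ((tendsto_pow_const_div_const_pow_of_one_lt 0 hr).const_mul _)
  rw [mul_zero, mul_zero, add_zero] at hlim
  obtain ⟨n, hn⟩ := (hlim.eventually (gt_mem_nhds one_pos)).exists
  have h1 : ((M : ℝ) + 1) ^ n ≤ (N * n + 1) * (M ^ n * B) := by exact_mod_cast hball n
  have hMn : (0 : ℝ) < (M : ℝ) ^ n := pow_pos hM0 n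
  have hM1n : (0 : ℝ) < ((M : ℝ) + 1) ^ n := pow_pos (by linarith) n
  rw [div_pow] at hn
  have h2 : (N : ℝ) * B * ((n : ℝ) ^ 1 / (((M : ℝ) + 1) ^ n / M ^ n)) +
      B * ((n : ℝ) ^ 0 / (((M : ℝ) + 1) ^ n / M ^ n)) =
      (N * n + 1) * (M ^ n * B) / ((M : ℝ) + 1) ^ n := by
    field_simp
  rw [h2, div_lt_one hM1n] at hn
  linarith

end SymGenSet

/-! ### Uniform lower bounds for balls and spheres of free groups, and the upper bound for standard
generators. -/

section FreeGroupGrowth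

variable {k : ℕ}

/-- Reduced words of length `n` in the free family contained in `S` are distinct elements of `B(n)`.
The subgroup generated by the family may be proper. -/
theorem pow_le_ncard_ball (hk : 1 ≤ k) (S : SymGenSet (FreeGroup (Fin k))) (n : ℕ) :
    (2 * k - 1) ^ n ≤ (S.ball n).ncard := by
  obtain ⟨s, hs, hinj⟩ := exists_free_family_of_closure_eq_top S.closure_eq_top
  obtain ⟨A, hA, hcard, -⟩ := exists_finset_norm_eq hk n
  have hlen : ∀ L : List (Fin k × Bool), S.length (FreeGroup.lift s (FreeGroup.mk L)) ≤ L.length := by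
    intro L
    rw [FreeGroup.lift_mk]
    refine (S.length_prod_le _ ?_).trans (by simp)
    intro g hg
    obtain ⟨⟨i, e⟩, -, rfl⟩ := List.mem_map.1 hg
    cases e
    · exact S.inv_mem _ (hs i)
    · exact hs i
  refine hcard.trans ?_
  rw [← Set.ncard_coe_finset, ← Set.ncard_image_of_injective _ hinj]
  refine Set.ncard_le_ncard ?_ (S.finite_ball n)
  rintro _ ⟨x, hx, rfl⟩
  have h := hlen x.toWord
  rw [FreeGroup.mk_toWord] at h
  exact h.trans (le_of_eq ((hA x).1 hx))

theorem infinite_freeGroup_fin (hk : 1 ≤ k) : Infinite (FreeGroup (Fin k)) := by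
  have : Nonempty (Fin k) := ⟨⟨0, hk⟩⟩
  exact Infinite.of_surjective _ (FreeGroup.norm_surjective (α := Fin k))

theorem pow_le_ncard_sphere_freeGroup (hk : 1 ≤ k) (S : SymGenSet (FreeGroup (Fin k))) (n : ℕ) :
    (2 * k - 1) ^ n ≤ (S.sphere n).ncard := by
  have := infinite_freeGroup_fin hk
  exact S.pow_le_ncard_sphere (pow_le_ncard_ball hk S) n

/-- The standard generators, their inverses and `1`. -/
def standardGenSet (k : ℕ) : SymGenSet (FreeGroup (Fin k)) where
  carrier := insert 1 (Finset.univ.image fun p : Fin k × Bool => FreeGroup.mk [p])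
  one_mem := Finset.mem_insert_self _ _
  inv_mem := by
    intro s hs
    rcases Finset.mem_insert.1 hs with rfl | hs
    · simp
    · obtain ⟨⟨i, e⟩, -, rfl⟩ := Finset.mem_image.1 hs
      refine Finset.mem_insert_of_mem (Finset.mem_image.2 ⟨(i, !e), Finset.mem_univ _, ?_⟩)
      simp [FreeGroup.inv_mk, FreeGroup.invRev]
  closure_eq_top := by
    rw [eq_top_iff, ← FreeGroup.closure_range_of, Subgroup.closure_le]
    rintro _ ⟨i, rfl⟩
    exact Subgroup.subset_closure (Finset.mem_insert_of_mem
      (Finset.mem_image.2 ⟨(i, true), Finset.mem_univ _, rfl⟩))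

theorem exists_norm_le_mul_length (T : SymGenSet (FreeGroup (Fin k))) {D : ℕ}
    (hD : ∀ t ∈ T.carrier, t.norm ≤ D) (g : FreeGroup (Fin k)) : g.norm ≤ D * T.length g := by
  obtain ⟨l, hl, hl1, rfl⟩ := T.isProdOf_length g
  rw [← hl]
  clear hl
  induction l with
  | nil => simp
  | cons t l ih =>
    rw [List.prod_cons, List.length_cons, mul_add, mul_one, add_comm]
    exact (FreeGroup.norm_mul_le _ _).trans (add_le_add (hD t (hl1 t (by simp)))
      (ih fun s hs => hl1 s (by simp [hs])))

theorem norm_le_length_standard (g : FreeGroup (Fin k)) :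
    g.norm ≤ (standardGenSet k).length g := by
  have := exists_norm_le_mul_length (standardGenSet k) (D := 1) (fun t ht => ?_) g
  · simpa using this
  · rcases Finset.mem_insert.1 ht with rfl | ht
    · simp
    · obtain ⟨p, -, rfl⟩ := Finset.mem_image.1 ht
      exact FreeGroup.norm_mk_le

theorem ncard_ball_standard_le (hk : 1 ≤ k) (n : ℕ) :
    ((standardGenSet k).ball n).ncard ≤ (n + 1) * (2 * k * (2 * k - 1) ^ n) := by
  choose A hA _ hcard using exists_finset_norm_eq hk
  calc ((standardGenSet k).ball n).ncard
      ≤ (((Finset.range (n + 1)).biUnion A : Finset _) : Set (FreeGroup (Fin k))).ncard := by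
        refine Set.ncard_le_ncard (fun g hg => ?_) (Finset.finite_toSet _)
        have h : g.norm ≤ n := (norm_le_length_standard g).trans hg
        simp only [Finset.coe_biUnion, Set.mem_iUnion]
        exact ⟨g.norm, by simpa [Nat.lt_succ_iff] using h, (hA _ _).2 rfl⟩
    _ ≤ ∑ i ∈ Finset.range (n + 1), (A i).card := by
        rw [Set.ncard_coe_finset]
        exact Finset.card_biUnion_le
    _ ≤ ∑ i ∈ Finset.range (n + 1), 2 * k * (2 * k - 1) ^ n :=
        Finset.sum_le_sum fun i hi => (hcard i).trans (Nat.mul_le_mul_left _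
          (Nat.pow_le_pow_right (by omega) (by simpa [Nat.lt_succ_iff] using hi)))
    _ = _ := by simp

end FreeGroupGrowth

/-! ### Exponential rates. -/

section LogLimits

/-- Polynomial factors do not change exponential rates. -/
theorem tendsto_log_mul_zpow_mul_pow_div {C q : ℝ} (hC : 0 < C) (hq : 0 < q) (e : ℤ) {N : ℕ → ℕ}
    (hN : Tendsto N atTop atTop) :
    Tendsto (fun n => Real.log (C * ((N n : ℝ) + 1) ^ e * q ^ N n) / (N n : ℝ)) atTop
      (𝓝 (Real.log q)) := by
  suffices h : Tendsto (fun n : ℕ => Real.log (C * ((n : ℝ) + 1) ^ e * q ^ n) / (n : ℝ)) atTop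
      (𝓝 (Real.log q)) from h.comp hN
  have h1 : Tendsto (fun n : ℕ => Real.log C / (n : ℝ)) atTop (𝓝 0) :=
    tendsto_const_div_atTop_nhds_zero_nat _
  have h2 : Tendsto (fun n : ℕ => Real.log ((n : ℝ) + 1) / (n : ℝ)) atTop (𝓝 0) := by
    have := (Real.tendsto_pow_log_div_mul_add_atTop 1 (-1) 1 one_ne_zero).comp
      (tendsto_natCast_atTop_atTop.comp (tendsto_add_atTop_nat 1))
    refine this.congr fun n => ?_
    simp
  have h3 := (h1.add (h2.const_mul (e : ℝ))).add_const (Real.log q)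
  rw [mul_zero, zero_add, zero_add] at h3
  refine h3.congr' ?_
  filter_upwards [eventually_gt_atTop 0] with n hn
  have hn' : (0 : ℝ) < n := by exact_mod_cast hn
  have hn1 : (0 : ℝ) < (n : ℝ) + 1 := by linarith
  rw [Real.log_mul (mul_pos hC (zpow_pos hn1 e)).ne' (pow_pos hq n).ne',
    Real.log_mul hC.ne' (zpow_pos hn1 e).ne', Real.log_zpow, Real.log_pow]
  field_simp

theorem log_ofReal_div_natCast {r : ℝ} (hr : 0 < r) (n : ℕ) :
    ENNReal.log (ENNReal.ofReal r) / (n : EReal) = ((Real.log r / n : ℝ) : EReal) := by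
  rw [ENNReal.log_ofReal_of_pos hr, EReal.coe_div]
  rfl

theorem limsup_log_div_le {a : ℕ → ℝ≥0∞} {r : ℕ → ℝ} {N : ℕ → ℕ} {l : ℝ} (hr : ∀ n, 0 < r n)
    (ha : ∀ᶠ n in atTop, a n ≤ ENNReal.ofReal (r n))
    (hl : Tendsto (fun n => Real.log (r n) / (N n : ℝ)) atTop (𝓝 l)) :
    limsup (fun n => ENNReal.log (a n) / (N n : EReal)) atTop ≤ l := by
  rw [← ((continuous_coe_real_ereal.tendsto l).comp hl).limsup_eq]
  refine limsup_le_limsup ?_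
  filter_upwards [ha] with n hn
  rw [Function.comp_apply, ← log_ofReal_div_natCast (hr n)]
  exact EReal.div_le_div_right_of_nonneg (Nat.cast_nonneg' _) (ENNReal.log_monotone hn)

theorem le_limsup_log_div {a : ℕ → ℝ≥0∞} {r : ℕ → ℝ} {N : ℕ → ℕ} {l : ℝ} (hr : ∀ n, 0 < r n)
    (ha : ∀ᶠ n in atTop, ENNReal.ofReal (r n) ≤ a n)
    (hl : Tendsto (fun n => Real.log (r n) / (N n : ℝ)) atTop (𝓝 l)) :
    (l : EReal) ≤ limsup (fun n => ENNReal.log (a n) / (N n : EReal)) atTop := by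
  rw [← ((continuous_coe_real_ereal.tendsto l).comp hl).limsup_eq]
  refine limsup_le_limsup ?_
  filter_upwards [ha] with n hn
  rw [Function.comp_apply, ← log_ofReal_div_natCast (hr n)]
  exact EReal.div_le_div_right_of_nonneg (Nat.cast_nonneg' _) (ENNReal.log_monotone hn)

end LogLimits

/-! ### Growth rates of free groups. -/

section GrowthRate

theorem SymGenSet.encard_ball {G : Type*} [Group G] (S : SymGenSet G) (n : ℕ) :
    ((S.ball n).encard : ℝ≥0∞) = ENNReal.ofReal ((S.ball n).ncard : ℝ) := by
  rw [← (S.finite_ball n).cast_ncard_eq, ENNReal.ofReal_natCast, ENat.toENNReal_coe]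

variable {k : ℕ}

theorem log_le_growthRate (hk : 1 ≤ k) (S : SymGenSet (FreeGroup (Fin k))) :
    (Real.log ((2 * k - 1 : ℕ) : ℝ) : EReal) ≤ growthRate S := by
  have hq : (0 : ℝ) < ((2 * k - 1 : ℕ) : ℝ) := by exact_mod_cast (by omega : 0 < 2 * k - 1)
  refine le_limsup_log_div (N := id) (r := fun n => 1 * ((n : ℝ) + 1) ^ (0 : ℤ) * _ ^ n) ?_ ?_
    (tendsto_log_mul_zpow_mul_pow_div one_pos hq 0 tendsto_id)
  · intro n
    positivity
  · refine .of_forall fun n => ?_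
    rw [S.encard_ball]
    refine ENNReal.ofReal_le_ofReal ?_
    rw [zpow_zero, one_mul, one_mul]
    exact_mod_cast pow_le_ncard_ball hk S n

theorem growthRate_standard_le (hk : 1 ≤ k) :
    growthRate (standardGenSet k) ≤ (Real.log ((2 * k - 1 : ℕ) : ℝ) : EReal) := by
  have hq : (0 : ℝ) < ((2 * k - 1 : ℕ) : ℝ) := by exact_mod_cast (by omega : 0 < 2 * k - 1)
  have hk' : (0 : ℝ) < 2 * k := by positivity
  refine limsup_log_div_le (N := id) (r := fun n => 2 * k * ((n : ℝ) + 1) ^ (1 : ℤ) * _ ^ n) ?_ ?_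
    (tendsto_log_mul_zpow_mul_pow_div hk' hq 1 tendsto_id)
  · intro n
    positivity
  · refine .of_forall fun n => ?_
    rw [SymGenSet.encard_ball]
    refine ENNReal.ofReal_le_ofReal ?_
    have h : (((standardGenSet k).ball n).ncard : ℝ) ≤
        (n + 1) * (2 * k * ((2 * k - 1 : ℕ) : ℝ) ^ n) := by
      exact_mod_cast ncard_ball_standard_le hk n
    rw [zpow_one]
    linarith

end GrowthRate

/-! ### Relative growth: colourings, geodesic chains and a pigeonhole argument. -/

section RelativeGrowth

variable {G : Type*} [Group G] (S : SymGenSet G)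

namespace SymGenSet

/-- Finite subsets of a Cayley graph have colourings with boundedly many colours for which close
points have different colours. -/
theorem exists_coloring (R : ℕ) (V : Finset G) : ∃ c : G → Fin (S.ball R).ncard,
    ∀ g ∈ V, ∀ h ∈ V, g ≠ h → S.length (g⁻¹ * h) ≤ R → c g ≠ c h := by
  classical
  have h1 : (1 : G) ∈ S.ball R := by
    change S.length 1 ≤ R
    rw [S.length_one]; exact Nat.zero_le _
  have hpos : 0 < (S.ball R).ncard := (Set.ncard_pos (S.finite_ball R)).2 ⟨1, h1⟩
  induction V using Finset.induction_on with
  | empty => exact ⟨fun _ => ⟨0, hpos⟩, by simp⟩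
  | insert g V hg ih =>
    obtain ⟨c, hc⟩ := ih
    let N := V.filter fun h => S.length (g⁻¹ * h) ≤ R
    -- Greedy colouring: the neighbours of `g` already coloured inject into the ball minus its
    -- centre, as `g` itself is new, so one colour is left.
    have hN : N.card < (S.ball R).ncard := by
      have h2 : N.card ≤ (S.ball R \ {1}).ncard := by
        rw [← Finset.card_image_of_injective N (mul_right_injective g⁻¹), ← Set.ncard_coe_finset]
        refine Set.ncard_le_ncard ?_ ((S.finite_ball R).subset Set.sdiff_subset)
        intro x hx
        obtain ⟨h, hh, rfl⟩ := Finset.mem_image.1 hx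
        obtain ⟨hV, hR⟩ := Finset.mem_filter.1 hh
        refine ⟨hR, fun h3 => hg ?_⟩
        rw [inv_mul_eq_one.1 (h3 : g⁻¹ * h = 1)]
        exact hV
      rw [Set.ncard_sdiff_singleton_of_mem h1] at h2
      omega
    obtain ⟨i, hi⟩ : ∃ i, i ∉ N.image c := by
      by_contra! h
      have h3 := Finset.card_le_card (fun i _ => h i : Finset.univ ⊆ N.image c)
      rw [Finset.card_univ, Fintype.card_fin] at h3
      exact absurd (h3.trans Finset.card_image_le) (not_le.2 hN)
    have hne : ∀ h ∈ V, S.length (g⁻¹ * h) ≤ R → i ≠ c h := fun h hV hR hih =>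
      hi (Finset.mem_image.2 ⟨h, Finset.mem_filter.2 ⟨hV, hR⟩, hih.symm⟩)
    have hVg : ∀ h ∈ V, h ≠ g := fun h hV hh => hg (hh ▸ hV)
    refine ⟨Function.update c g i, fun x hx y hy hxy hR => ?_⟩
    rcases Finset.mem_insert.1 hx with rfl | hx'
    · rcases Finset.mem_insert.1 hy with rfl | hy'
      · exact absurd rfl hxy
      · rw [Function.update_self, Function.update_of_ne (hVg y hy')]
        exact hne y hy' hR
    · rcases Finset.mem_insert.1 hy with rfl | hy'
      · rw [Function.update_self, Function.update_of_ne (hVg x hx')]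
        refine (hne x hx' ?_).symm
        rwa [← S.length_inv, mul_inv_rev, inv_inv]
      · rw [Function.update_of_ne (hVg x hx'), Function.update_of_ne (hVg y hy')]
        exact hc x hx' y hy' hxy hR

/-- Chains along geodesics: every element of `S(mn)` is joined to `1` by a chain with steps of
length `m`, and the predecessor in a chain is a function of the element. -/
theorem exists_geodesic_chains (m : ℕ) : ∃ P : G → G, ∀ n, ∀ a ∈ S.sphere (m * n), ∀ ε lam : ℝ,
    0 ≤ lam * ε → IsRelChain S m ε lam n a fun j => P^[n - j] a := by
  have h : ∀ g : G, ∃ u, m ≤ S.length g → S.length u = S.length g - m ∧ S.length (u⁻¹ * g) = m := by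
    intro g
    by_cases hm : m ≤ S.length g
    · obtain ⟨u, v, rfl, hu, hv⟩ :=
        S.exists_mul_of_length_eq_add (a := S.length g - m) (b := m) (g := g) (by omega)
      exact ⟨u, fun _ => ⟨hu, by rwa [inv_mul_cancel_left]⟩⟩
    · exact ⟨1, fun h => absurd h hm⟩
  choose P hP using h
  refine ⟨P, fun n a ha ε lam hε => ?_⟩
  have hlen : ∀ i ≤ n, S.length (P^[i] a) = (n - i) * m := by
    intro i hi
    induction i with
    | zero => rw [Nat.sub_zero, mul_comm]; exact ha
    | succ i ih =>
      have ih' := ih (by omega)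
      have hni : n - i = (n - (i + 1)) + 1 := by omega
      rw [hni, add_mul, one_mul] at ih'
      rw [Function.iterate_succ_apply', (hP _ (by omega)).1, ih', Nat.add_sub_cancel]
  refine ⟨?_, by simp, fun j hj => ?_, fun j hj => ?_⟩
  · exact S.length_eq_zero_iff.1 (by rw [Nat.sub_zero, hlen n le_rfl]; simp)
  · change S.length _ = _
    rw [hlen _ (by omega), Nat.sub_sub_self hj]
  · have h1 : n - j = (n - (j + 1)) + 1 := by omega
    have h2 := hlen (n - (j + 1)) (by omega)
    rw [Nat.sub_sub_self (by omega), add_mul, one_mul] at h2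
    rw [h1, Function.iterate_succ_apply', wdist, (hP _ (by omega)).2]
    linarith

end SymGenSet

/-- A positive proportion of the spheres, up to exponential error independent of `m`, is relatively
separated. -/
theorem ncard_sphere_div_le_relNumber (m : ℕ) {ε lam : ℝ} (hε : 0 ≤ lam * ε) (n : ℕ) :
    ENNReal.ofReal ((S.sphere (m * n)).ncard / ((S.ball ⌈ε⌉₊).ncard : ℝ) ^ n) ≤
      relNumber S m ε lam n := by
  classical
  set K := (S.ball ⌈ε⌉₊).ncard with hKdef
  obtain ⟨P, hP⟩ := S.exists_geodesic_chains m
  obtain ⟨c, hc⟩ := S.exists_coloring ⌈ε⌉₊ (S.finite_ball (m * n)).toFinset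
  have hK : 0 < K := (c 1).pos
  have hK' : (0 : ℝ) < K := by exact_mod_cast hK
  -- The colours of the `n` chain points after the initial one. There are `K ^ n` such words, and
  -- `K` does not depend on `m`; the pigeonhole principle selects a large fibre.
  let F : G → Fin n → Fin K := fun a j => c (P^[n - (j + 1)] a)
  let s := (S.finite_sphere (m * n)).toFinset
  have hs : s.card = (S.sphere (m * n)).ncard :=
    (Set.ncard_eq_toFinset_card _ (S.finite_sphere (m * n))).symm
  have : Nonempty (Fin K) := ⟨c 1⟩
  obtain ⟨y, -, hy⟩ := Finset.exists_le_card_fiber_of_nsmul_le_card_of_maps_to (s := s)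
    (t := (Finset.univ : Finset (Fin n → Fin K))) (f := F)
    (b := (s.card : ℝ) / (K : ℝ) ^ n) (fun _ _ => Finset.mem_univ _) Finset.univ_nonempty (by
      rw [Finset.card_univ, Fintype.card_fun, Fintype.card_fin, Fintype.card_fin, nsmul_eq_mul,
        Nat.cast_pow, mul_div_cancel₀ _ (pow_pos hK' n).ne'])
  rw [hs] at hy
  refine (ENNReal.ofReal_le_ofReal hy).trans ?_
  rw [ENNReal.ofReal_natCast]
  refine le_iSup₂_of_le (s.filter fun a => F a = y) ⟨fun a ha => ?_, fun a ha b hb => ?_⟩ le_rfl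
  · exact (Set.Finite.mem_toFinset _).1 (Finset.mem_filter.1 ha).1
  · obtain ⟨ha, hFa⟩ := Finset.mem_filter.1 ha
    obtain ⟨hb, hFb⟩ := Finset.mem_filter.1 hb
    have hca := hP n a ((Set.Finite.mem_toFinset _).1 ha) ε lam hε
    have hcb := hP n b ((Set.Finite.mem_toFinset _).1 hb) ε lam hε
    -- After the last coincidence the next chain points are distinct but have the same colour, so
    -- the colouring forces them apart.
    refine ⟨_, _, hca, hcb, fun j hj _ hne => ?_⟩
    by_contra! hlt
    have hmem : ∀ a, IsRelChain S m ε lam n a (fun j => P^[n - j] a) →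
        P^[n - (j + 1)] a ∈ (S.finite_ball (m * n)).toFinset := by
      intro a h
      rw [Set.Finite.mem_toFinset]
      have h1 : S.length _ = _ := h.mem_sphere (j + 1) hj
      change S.length _ ≤ _
      rw [h1, mul_comm]
      exact Nat.mul_le_mul_left _ hj
    refine hc _ (hmem a hca) _ (hmem b hcb) (hne (j + 1) (by omega) hj) ?_
      (congrFun (hFa.trans hFb.symm) ⟨j, hj⟩)
    have h2 := hlt.le.trans (Nat.le_ceil ε)
    simp only [SymGenSet.wdist] at h2
    exact_mod_cast h2

theorem relNumber_le (m : ℕ) (ε lam : ℝ) (n : ℕ) :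
    relNumber S m ε lam n ≤ ENNReal.ofReal ((S.ball (m * n)).ncard : ℝ) := by
  refine iSup₂_le fun A hA => ?_
  rw [ENNReal.ofReal_natCast, Nat.cast_le, ← Set.ncard_coe_finset]
  exact Set.ncard_le_ncard (hA.1.trans fun g hg => le_of_eq hg) (S.finite_ball _)

variable {k : ℕ}

theorem relGrowthRateFun_standard_le (hk : 1 ≤ k) (μ : ℝ → ℝ → ℕ) (τ : ℝ → ℝ≥0) :
    relGrowthRateFun (standardGenSet k) μ τ ≤ (Real.log ((2 * k - 1 : ℕ) : ℝ) : EReal) := by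
  have hq : (0 : ℝ) < ((2 * k - 1 : ℕ) : ℝ) := by exact_mod_cast (by omega : 0 < 2 * k - 1)
  have hk' : (0 : ℝ) < 2 * k := by positivity
  refine iSup_le fun m => iSup_le fun ε => iSup_le fun lam => iSup_le fun h => ?_
  have hm : 0 < m := by have := h.2.2; omega
  refine limsup_log_div_le (N := fun n => m * n)
    (r := fun n => 2 * k * (((m * n : ℕ) : ℝ) + 1) ^ (1 : ℤ) * _ ^ (m * n)) ?_ ?_
    (tendsto_log_mul_zpow_mul_pow_div hk' hq 1 (tendsto_id.const_mul_atTop' hm))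
  · intro n
    positivity
  · refine .of_forall fun n => (relNumber_le _ m ε lam n).trans (ENNReal.ofReal_le_ofReal ?_)
    have h : (((standardGenSet k).ball (m * n)).ncard : ℝ) ≤
        ((m * n : ℕ) + 1) * (2 * k * ((2 * k - 1 : ℕ) : ℝ) ^ (m * n)) := by
      exact_mod_cast ncard_ball_standard_le hk (m * n)
    rw [zpow_one]
    linarith

/-- Fix `λ = 1/2` and an admissible `ε`. Each large `m` gives at least `log q - log K / m` with `K`
fixed, and the supremum over `m` removes the error whatever `μ` is. -/
theorem log_le_relGrowthRateFun (hk : 1 ≤ k) (S : SymGenSet (FreeGroup (Fin k)))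
    (μ : ℝ → ℝ → ℕ) (τ : ℝ → ℝ≥0) :
    (Real.log ((2 * k - 1 : ℕ) : ℝ) : EReal) ≤ relGrowthRateFun S μ τ := by
  have hq : (0 : ℝ) < ((2 * k - 1 : ℕ) : ℝ) := by exact_mod_cast (by omega : 0 < 2 * k - 1)
  set q : ℝ := ((2 * k - 1 : ℕ) : ℝ)
  set ε : ℝ := τ (1 / 2) + 1 with hε
  have hε0 : 0 ≤ ε := by positivity
  set K : ℝ := ((S.ball ⌈ε⌉₊).ncard : ℝ) with hK
  have hK0 : 0 < K := by
    have : 0 < (S.ball ⌈ε⌉₊).ncard :=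
      (Set.ncard_pos (S.finite_ball _)).2 ⟨1, by
        change S.length 1 ≤ _
        rw [S.length_one]; exact Nat.zero_le _⟩
    exact Nat.cast_pos.2 this
  have hlim : Tendsto (fun m : ℕ => ((Real.log q - Real.log K / m : ℝ) : EReal)) atTop
      (𝓝 (Real.log q : EReal)) := by
    have h := (tendsto_const_div_atTop_nhds_zero_nat (Real.log K)).const_sub (Real.log q)
    rw [sub_zero] at h
    exact (continuous_coe_real_ereal.tendsto _).comp h
  refine le_of_tendsto hlim ?_
  filter_upwards [eventually_gt_atTop (μ (1 / 2) ε)] with m hm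
  have hm0 : (0 : ℝ) < m := by exact_mod_cast (by omega : 0 < m)
  refine le_iSup_of_le m (le_iSup_of_le ε (le_iSup_of_le (1 / 2) (le_iSup_of_le
    ⟨⟨by norm_num, by norm_num⟩, by rw [hε]; linarith, hm⟩ ?_)))
  refine le_limsup_log_div (N := fun n => m * n) (r := fun n => q ^ (m * n) / K ^ n) ?_ ?_ ?_
  · intro n
    positivity
  · refine .of_forall fun n => le_trans (ENNReal.ofReal_le_ofReal ?_)
      (ncard_sphere_div_le_relNumber S m (by positivity : 0 ≤ 1 / 2 * ε) n)
    rw [← hK]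
    gcongr
    rw [← Nat.cast_pow, Nat.cast_le]
    exact pow_le_ncard_sphere_freeGroup hk S (m * n)
  · refine tendsto_const_nhds.congr' ?_
    filter_upwards [eventually_gt_atTop 0] with n hn
    have hn' : (0 : ℝ) < n := by exact_mod_cast hn
    rw [Real.log_div (pow_pos hq _).ne' (pow_pos hK0 _).ne', Real.log_pow, Real.log_pow]
    push_cast
    field_simp

end RelativeGrowth

/-! ### Concatenation without cancellation. -/

namespace FreeGroup

variable {α : Type*} [DecidableEq α]

theorem norm_mul_eq_add_iff {g h : FreeGroup α} :
    (g * h).norm = g.norm + h.norm ↔ commonPrefix g⁻¹ h = 0 := by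
  have := norm_inv_mul_add g⁻¹ h
  rw [inv_inv, norm_inv_eq] at this
  omega

theorem commonPrefix_mul_right {g h : FreeGroup α} (hgh : (g * h).norm = g.norm + h.norm) :
    commonPrefix g (g * h) = g.norm := by
  have := norm_inv_mul_add g (g * h)
  rw [inv_mul_cancel_left] at this
  omega

/-- Some positive or negative powers of a generator can be appended without cancellation. -/
theorem exists_norm_mul_pow (i : α) (w : FreeGroup α) :
    ∃ a : FreeGroup α, ∀ n, (a ^ n).norm = n ∧ (w * a ^ n).norm = w.norm + n := by
  have h1 : ∀ n, (of i ^ n).norm = n := norm_of_pow i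
  have h2 : ∀ n, ((of i)⁻¹ ^ n).norm = n := fun n => by rw [inv_pow, norm_inv_eq, h1]
  have h3 : ∀ n m, commonPrefix (of i ^ n) ((of i)⁻¹ ^ m) = 0 := by
    intro n m
    have h := norm_inv_mul_add (of i ^ n) ((of i)⁻¹ ^ m)
    rw [← inv_pow, ← pow_add, h1, h2, h2] at h
    omega
  by_cases h : ∀ n, commonPrefix w⁻¹ (of i ^ n) = 0
  · exact ⟨of i, fun n => ⟨h1 n, by rw [norm_mul_eq_add_iff.2 (h n), h1]⟩⟩
  · push Not at h
    obtain ⟨n, hn⟩ := h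
    refine ⟨(of i)⁻¹, fun m => ⟨h2 m, ?_⟩⟩
    rw [norm_mul_eq_add_iff.2, h2]
    -- Positive and negative powers of a generator share no prefix, so `w⁻¹` cannot share a prefix
    -- with both.
    have h4 := min_commonPrefix_le (of i ^ n) w⁻¹ ((of i)⁻¹ ^ m)
    rw [h3, commonPrefix_comm] at h4
    omega

end FreeGroup

/-! ### Comparison of an arbitrary Cayley graph with the Cayley tree. -/

section QuasiTree

variable {k : ℕ} (T : SymGenSet (FreeGroup (Fin k)))

theorem length_le_mul_norm {D : ℕ} (hD : ∀ i, T.length (FreeGroup.of i) ≤ D)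
    (x : FreeGroup (Fin k)) : T.length x ≤ D * x.norm := by
  have h : ∀ L : List (Fin k × Bool), T.length (FreeGroup.mk L) ≤ D * L.length := by
    intro L
    induction L with
    | nil =>
      rw [← FreeGroup.one_eq_mk, T.length_one]
      exact Nat.zero_le _
    | cons p L ih =>
      have h1 : FreeGroup.mk (p :: L) = FreeGroup.mk [p] * FreeGroup.mk L := by
        rw [FreeGroup.mul_mk]; rfl
      have h2 : T.length (FreeGroup.mk [p]) ≤ D := by
        rcases p with ⟨i, e⟩
        cases e
        · have : FreeGroup.mk [(i, false)] = (FreeGroup.of i)⁻¹ := by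
            simp [FreeGroup.of, FreeGroup.inv_mk, FreeGroup.invRev]
          rw [this, T.length_inv]
          exact hD i
        · exact hD i
      rw [h1, List.length_cons, mul_add, mul_one, add_comm]
      exact (T.length_mul_le _ _).trans (add_le_add h2 ih)
  have := h x.toWord
  rwa [FreeGroup.mk_toWord] at this

/-- A path which separates from `g⁻¹` at some time is close to the identity at that time. -/
theorem exists_append_norm_le {D : ℕ} {g : FreeGroup (Fin k)} (l : List (FreeGroup (Fin k)))
    (hl : ∀ t ∈ l, t.norm ≤ D) (q : FreeGroup (Fin k)) (hq : 0 < FreeGroup.commonPrefix g⁻¹ q)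
    (hq' : FreeGroup.commonPrefix g⁻¹ (q * l.prod) = 0) :
    ∃ l₁ l₂, l = l₁ ++ l₂ ∧ (q * l₁.prod).norm ≤ D := by
  induction l generalizing q with
  | nil => simp at hq'; omega
  | cons t l ih =>
    by_cases h : FreeGroup.commonPrefix g⁻¹ (q * t) = 0
    · refine ⟨[t], l, rfl, ?_⟩
      -- At this step the path leaves the branch of `g⁻¹`, so `q` and `q * t` have no common prefix;
      -- then `t.norm` is the sum of their norms.
      have h1 := FreeGroup.min_commonPrefix_le g⁻¹ q (q * t)
      have h2 := FreeGroup.norm_inv_mul_add q (q * t)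
      rw [inv_mul_cancel_left] at h2
      have h3 := hl t (by simp)
      rw [List.prod_singleton]
      omega
    · obtain ⟨l₁, l₂, rfl, h2⟩ := ih (fun s hs => hl s (by simp [hs])) (q * t)
        (Nat.pos_of_ne_zero h) (by rwa [List.prod_cons, ← mul_assoc] at hq')
      exact ⟨t :: l₁, l₂, rfl, by rwa [List.prod_cons, ← mul_assoc]⟩

/-- Lengths are additive up to a constant along geodesics of the Cayley tree. -/
theorem exists_length_add_le : ∃ C : ℕ, ∀ g h : FreeGroup (Fin k),
    (g * h).norm = g.norm + h.norm → T.length g + T.length h ≤ T.length (g * h) + C := by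
  obtain ⟨D, hD⟩ : ∃ D, ∀ i, T.length (FreeGroup.of i) ≤ D :=
    ⟨∑ i, T.length (FreeGroup.of i), fun i =>
      Finset.single_le_sum (f := fun i => T.length (FreeGroup.of i)) (fun _ _ => Nat.zero_le _)
        (Finset.mem_univ i)⟩
  obtain ⟨E, hE⟩ : ∃ E, ∀ t ∈ T.carrier, t.norm ≤ E :=
    ⟨T.carrier.sup FreeGroup.norm, fun t ht => Finset.le_sup (f := FreeGroup.norm) ht⟩
  -- A `T`-geodesic for `g * h`, translated by `g⁻¹`, runs from `g⁻¹` to `h` and passes within tree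
  -- distance `E` of the identity, hence within `T`-distance `D * E`. The detour through the
  -- identity costs this twice.
  refine ⟨2 * (D * E), fun g h hgh => ?_⟩
  rw [FreeGroup.norm_mul_eq_add_iff] at hgh
  rcases eq_or_ne g 1 with rfl | hg
  · simp [T.length_one]
  obtain ⟨l, hl, hl1, hl2⟩ := T.isProdOf_length (g * h)
  have hpos : 0 < FreeGroup.commonPrefix g⁻¹ g⁻¹ := by
    rw [FreeGroup.commonPrefix_self, FreeGroup.norm_inv_eq, Nat.pos_iff_ne_zero, Ne,
      FreeGroup.norm_eq_zero]
    exact hg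
  obtain ⟨l₁, l₂, rfl, h2⟩ := exists_append_norm_le l (fun t ht => hE t (hl1 t ht)) g⁻¹ hpos
    (by rwa [hl2, inv_mul_cancel_left])
  have hr : T.length (g⁻¹ * l₁.prod) ≤ D * E :=
    (length_le_mul_norm T hD _).trans (Nat.mul_le_mul_left _ h2)
  have h3 := T.length_prod_le l₁ fun t ht => hl1 t (by simp [ht])
  have h4 := T.length_prod_le l₂ fun t ht => hl1 t (by simp [ht])
  have h5 := T.length_mul_le l₁.prod (g⁻¹ * l₁.prod)⁻¹
  have h6 := T.length_mul_le (g⁻¹ * l₁.prod) l₂.prod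
  rw [T.length_inv, mul_inv_rev, inv_inv, mul_inv_cancel_left] at h5
  rw [mul_assoc, ← List.prod_append, hl2, inv_mul_cancel_left] at h6
  rw [List.length_append] at hl
  omega

/-- Up to constants, the Gromov product of a Cayley graph of a free group is the length of the
common prefix. -/
def IsPrefixComparable (C D : ℝ) : Prop :=
  ∀ p q : CayleyGraph T,
    (FreeGroup.commonPrefix p.src q.src : ℝ) / D - C ≤ gromovProduct (CayleyGraph.vertex T 1) p q ∧
    gromovProduct (CayleyGraph.vertex T 1) p q ≤ D * FreeGroup.commonPrefix p.src q.src + C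

theorem CayleyGraph.dist_vertex {G : Type*} [Group G] (S : SymGenSet G) (g h : G) :
    dist (vertex S g) (vertex S h) = S.wdist g h := by
  have h0 : ∀ g, (vertex S g).toSrc = 0 := fun g => by simp [vertex, toSrc]
  have h1 : ∀ g, (vertex S g).tgt = g := fun g => by simp [vertex, tgt]
  have h2 : ∀ g, (vertex S g).toTgt = 0 := fun g => by
    rw [toTgt, h1]; exact mul_eq_zero_of_right _ (S.wdist_self g)
  have h3 : ∀ g, (vertex S g).src = g := fun g => rfl
  change pdist _ _ = _
  rcases pdist_cases (vertex S g) (vertex S h) with ⟨e, -, f⟩ | ⟨e, -, f⟩ | f | f | f | f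
  · rw [f, h0, h0]
    rw [h3, h3] at e
    simp [e, S.wdist_self]
  · rw [f, h0, h2]
    rw [h3, h1] at e
    simp [e, S.wdist_self]
  all_goals simpa [h0, h1, h2, h3] using f

theorem CayleyGraph.dist_vertex_src_le {G : Type*} [Group G] {S : SymGenSet G}
    (p : CayleyGraph S) : dist p (vertex S p.src) ≤ 1 := by
  have h := (pdist_le p (vertex S p.src)).1
  have h1 : (vertex S p.src).toSrc = 0 := by simp [vertex, toSrc]
  have h2 : (vertex S p.src).src = p.src := rfl
  rw [h1, h2, S.wdist_self, add_zero, add_zero] at h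
  refine h.trans (mul_le_one₀ p.t_mem.2 (S.wdist_nonneg _ _) ?_)
  rw [SymGenSet.wdist, tgt, inv_mul_cancel_left]
  exact_mod_cast S.length_le_one_of_mem p.dir_mem

theorem abs_gromovProduct_sub_le {X : Type*} [PseudoMetricSpace X] (x₀ p q p' q' : X) :
    |gromovProduct x₀ p q - gromovProduct x₀ p' q'| ≤ dist p p' + dist q q' := by
  have h1 := dist_triangle x₀ p p'
  have h2 := dist_triangle x₀ p' p
  have h3 := dist_triangle x₀ q q'
  have h4 := dist_triangle x₀ q' q
  have h5 := dist_triangle4 p p' q' q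
  have h6 := dist_triangle4 p' p q q'
  rw [dist_comm p' p] at h2 h6
  rw [dist_comm q' q] at h4 h5
  rw [abs_le]
  constructor <;> simp only [gromovProduct] <;> linarith

theorem exists_isPrefixComparable : ∃ C D : ℝ, 0 < D ∧ IsPrefixComparable T C D := by
  obtain ⟨D, hD⟩ : ∃ D, ∀ i, T.length (FreeGroup.of i) ≤ D :=
    ⟨∑ i, T.length (FreeGroup.of i), fun i =>
      Finset.single_le_sum (f := fun i => T.length (FreeGroup.of i)) (fun _ _ => Nat.zero_le _)
        (Finset.mem_univ i)⟩
  obtain ⟨E, hE⟩ : ∃ E, ∀ t ∈ T.carrier, t.norm ≤ E :=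
    ⟨T.carrier.sup FreeGroup.norm, fun t ht => Finset.le_sup (f := FreeGroup.norm) ht⟩
  obtain ⟨C, hC⟩ := exists_length_add_le T
  -- The `2` pays for replacing the two points by source vertices. Between vertices the Gromov
  -- product equals the `T`-length of the branch point up to `C`, and `D` and `E` compare `T`-length
  -- with norm in the two directions.
  refine ⟨C + 2, D + E + 1, by positivity, fun p q => ?_⟩
  obtain ⟨u, a, b, hx, hy, h1, h2, h3, h4⟩ := FreeGroup.exists_branch p.src q.src
  have hgp : |gromovProduct (CayleyGraph.vertex T 1) p q - gromovProduct (CayleyGraph.vertex T 1)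
      (CayleyGraph.vertex T p.src) (CayleyGraph.vertex T q.src)| ≤ 2 :=
    (abs_gromovProduct_sub_le _ _ _ _ _).trans
      (by linarith [p.dist_vertex_src_le, q.dist_vertex_src_le])
  have hab : p.src⁻¹ * q.src = a⁻¹ * b := by rw [hx, hy]; group
  have hv : gromovProduct (CayleyGraph.vertex T 1) (CayleyGraph.vertex T p.src)
      (CayleyGraph.vertex T q.src) =
        ((T.length p.src : ℝ) + T.length q.src - T.length (a⁻¹ * b)) / 2 := by
    rw [gromovProduct, CayleyGraph.dist_vertex, CayleyGraph.dist_vertex, CayleyGraph.dist_vertex,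
      SymGenSet.wdist, SymGenSet.wdist, SymGenSet.wdist, inv_one, one_mul, one_mul, hab]
  rw [hv, abs_le] at hgp
  have e1 : T.length u + T.length a ≤ T.length p.src + C := by
    rw [hx]; exact hC u a (by rw [← hx, h2])
  have e2 : T.length u + T.length b ≤ T.length q.src + C := by
    rw [hy]; exact hC u b (by rw [← hy, h3])
  have e3 : T.length a + T.length b ≤ T.length (a⁻¹ * b) + C := by
    rw [← T.length_inv a]
    exact hC a⁻¹ b (by rw [← hab, h4, FreeGroup.norm_inv_eq])
  have e4 : T.length p.src ≤ T.length u + T.length a := by rw [hx]; exact T.length_mul_le u a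
  have e5 : T.length q.src ≤ T.length u + T.length b := by rw [hy]; exact T.length_mul_le u b
  have e6 : T.length (a⁻¹ * b) ≤ T.length a + T.length b := by
    rw [← T.length_inv a]; exact T.length_mul_le _ _
  have e7 := length_le_mul_norm T hD u
  have e8 := exists_norm_le_mul_length T hE u
  rw [h1] at e7 e8
  set c := FreeGroup.commonPrefix p.src q.src
  have f1 : (T.length u : ℝ) + T.length a ≤ T.length p.src + C := by exact_mod_cast e1
  have f2 : (T.length u : ℝ) + T.length b ≤ T.length q.src + C := by exact_mod_cast e2
  have f3 : (T.length a : ℝ) + T.length b ≤ T.length (a⁻¹ * b) + C := by exact_mod_cast e3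
  have f4 : (T.length p.src : ℝ) ≤ T.length u + T.length a := by exact_mod_cast e4
  have f5 : (T.length q.src : ℝ) ≤ T.length u + T.length b := by exact_mod_cast e5
  have f6 : (T.length (a⁻¹ * b) : ℝ) ≤ T.length a + T.length b := by exact_mod_cast e6
  have f7 : (T.length u : ℝ) ≤ D * c := by exact_mod_cast e7
  have f8 : (c : ℝ) ≤ E * T.length u := by exact_mod_cast e8
  have hc : (0 : ℝ) ≤ c := Nat.cast_nonneg c
  have hC0 : (0 : ℝ) ≤ C := Nat.cast_nonneg C
  have hD0 : (0 : ℝ) ≤ D := Nat.cast_nonneg D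
  have hE0 : (0 : ℝ) ≤ E := Nat.cast_nonneg E
  have hu0 : (0 : ℝ) ≤ T.length u := Nat.cast_nonneg _
  constructor
  · have : (c : ℝ) / (D + E + 1) ≤ T.length u := by
      rw [div_le_iff₀ (by positivity)]
      nlinarith
    linarith
  · have : (D : ℝ) * c ≤ (D + E + 1) * c := by nlinarith
    linarith

end QuasiTree

/-! ### The chain distance on a Gromov boundary. -/

section ChainMetric

variable {X : Type*} [PseudoMetricSpace X] {x₀ : X}

theorem gromovProduct_comm (x₀ y z : X) : gromovProduct x₀ y z = gromovProduct x₀ z y := by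
  rw [gromovProduct, gromovProduct, dist_comm y z, add_comm (dist x₀ y)]

theorem liminf_prod_swap (F : ℕ × ℕ → EReal) :
    liminf F (atTop ×ˢ atTop) = liminf (fun p => F p.swap) (atTop ×ˢ atTop) := by
  conv_lhs => rw [prod_comm]
  rfl

theorem boundaryProduct_le_comm (ξ ζ : GromovBoundary x₀) :
    boundaryProduct ξ ζ ≤ boundaryProduct ζ ξ := by
  refine iSup_le fun x => iSup_le fun y => iSup_le fun h =>
    le_iSup_of_le y (le_iSup_of_le x (le_iSup_of_le ⟨h.2, h.1⟩ (le_of_eq ?_)))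
  rw [liminf_prod_swap]
  simp only [Prod.fst_swap, Prod.snd_swap]
  exact congrArg₂ _ (funext fun p => congrArg _ (gromovProduct_comm _ _ _)) rfl

theorem boundaryRho_comm (η : ℝ) (ξ ζ : GromovBoundary x₀) :
    boundaryRho η ξ ζ = boundaryRho η ζ ξ := by
  rw [boundaryRho, boundaryRho,
    le_antisymm (boundaryProduct_le_comm ξ ζ) (boundaryProduct_le_comm ζ ξ)]

theorem boundaryDist_le_boundaryRho (η : ℝ) (ξ ζ : GromovBoundary x₀) :
    boundaryDist η ξ ζ ≤ boundaryRho η ξ ζ :=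
  iInf_le_of_le 0 (iInf_le_of_le (fun i => if i = 0 then ξ else ζ) (iInf_le_of_le (by simp)
    (by simp)))

theorem boundaryDist_le_comm (η : ℝ) (ξ ζ : GromovBoundary x₀) :
    boundaryDist η ξ ζ ≤ boundaryDist η ζ ξ := by
  refine le_iInf fun k => le_iInf fun c => le_iInf fun h =>
    iInf_le_of_le k (iInf_le_of_le (fun i => c (k + 1 - i)) (iInf_le_of_le ?_ ?_))
  · simpa using h.symm
  · rw [← Finset.sum_range_reflect]
    refine Finset.sum_le_sum fun i hi => ?_
    have hi' : i < k + 1 := Finset.mem_range.1 hi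
    have h1 : k + 1 - (k + 1 - 1 - i) = i + 1 := by omega
    have h2 : k + 1 - (k + 1 - 1 - i + 1) = i := by omega
    simp only [h1, h2]
    exact (boundaryRho_comm _ _ _).le

theorem boundaryDist_triangle (η : ℝ) (ξ ζ χ : GromovBoundary x₀) :
    boundaryDist η ξ χ ≤ boundaryDist η ξ ζ + boundaryDist η ζ χ := by
  have key : ∀ (k : ℕ) (c : ℕ → GromovBoundary x₀), c 0 = ξ ∧ c (k + 1) = ζ →
      ∀ (l : ℕ) (d : ℕ → GromovBoundary x₀), d 0 = ζ ∧ d (l + 1) = χ →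
      boundaryDist η ξ χ ≤ ∑ i ∈ Finset.range (k + 1), boundaryRho η (c i) (c (i + 1)) +
        ∑ i ∈ Finset.range (l + 1), boundaryRho η (d i) (d (i + 1)) := by
    intro k c hc l d hd
    -- Concatenation of chains; the junction index `k + 1` takes its value from `d`, which starts at
    -- `ζ` where `c` ends.
    refine iInf_le_of_le (k + 1 + l) (iInf_le_of_le
      (fun i => if i < k + 1 then c i else d (i - (k + 1))) (iInf_le_of_le ⟨?_, ?_⟩ ?_))
    · simpa using hc.1
    · dsimp only
      rw [if_neg (by omega), show k + 1 + l + 1 - (k + 1) = l + 1 by omega, hd.2]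
    · rw [show k + 1 + l + 1 = k + 1 + (l + 1) by omega, Finset.sum_range_add]
      refine le_of_eq (congrArg₂ _ (Finset.sum_congr rfl fun i hi => ?_)
        (Finset.sum_congr rfl fun i _ => ?_))
      · have hi' : i < k + 1 := Finset.mem_range.1 hi
        dsimp only
        rw [if_pos hi']
        split_ifs with h
        · rfl
        · have : i = k := by omega
          subst this
          simp [hc.2, hd.1]
      · dsimp only
        rw [if_neg (by omega), if_neg (by omega), Nat.add_sub_cancel_left,
          show k + 1 + i + 1 - (k + 1) = i + 1 by omega]
  have key2 : ∀ (k : ℕ) (c : ℕ → GromovBoundary x₀), c 0 = ξ ∧ c (k + 1) = ζ →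
      boundaryDist η ξ χ ≤ ∑ i ∈ Finset.range (k + 1), boundaryRho η (c i) (c (i + 1)) +
        boundaryDist η ζ χ := by
    intro k c hc
    rw [boundaryDist.eq_def η ζ χ]
    simp only [ENNReal.add_iInf]
    exact le_iInf fun l => le_iInf fun d => le_iInf fun hd => key k c hc l d hd
  rw [boundaryDist.eq_def η ξ ζ]
  simp only [ENNReal.iInf_add]
  exact le_iInf fun k => le_iInf fun c => le_iInf fun hc => key2 k c hc

theorem boundaryRho_le_of_le {η b : ℝ} (hη : 0 ≤ η) {ξ ζ : GromovBoundary x₀}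
    (h : (b : EReal) ≤ boundaryProduct ξ ζ) :
    boundaryRho η ξ ζ ≤ ENNReal.ofReal (Real.exp (-(η * b))) := by
  rw [← EReal.exp_coe, boundaryRho, EReal.exp_le_exp_iff, EReal.coe_neg, EReal.neg_le_neg_iff,
    EReal.coe_mul]
  exact mul_le_mul_of_nonneg_left h (by exact_mod_cast hη)

theorem le_boundaryRho_of_le {η b : ℝ} (hη : 0 ≤ η) {ξ ζ : GromovBoundary x₀}
    (h : boundaryProduct ξ ζ ≤ b) :
    ENNReal.ofReal (Real.exp (-(η * b))) ≤ boundaryRho η ξ ζ := by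
  rw [← EReal.exp_coe, boundaryRho, EReal.exp_le_exp_iff, EReal.coe_neg, EReal.neg_le_neg_iff,
    EReal.coe_mul]
  exact mul_le_mul_of_nonneg_left h (by exact_mod_cast hη)

/-- If the points of different classes are at bounded product, then `d_η` separates them. -/
theorem le_boundaryDist_of_ne {η b : ℝ} (hη : 0 ≤ η) {β : Type*} (f : GromovBoundary x₀ → β)
    (hf : ∀ ξ ζ, f ξ ≠ f ζ → boundaryProduct ξ ζ ≤ b) {ξ ζ : GromovBoundary x₀} (h : f ξ ≠ f ζ) :
    ENNReal.ofReal (Real.exp (-(η * b))) ≤ boundaryDist η ξ ζ := by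
  refine le_iInf fun k => le_iInf fun c => le_iInf fun hc => ?_
  -- A chain between different classes has a link that changes class, and this single summand gives
  -- the bound. Hence no smallness of `η` is needed.
  obtain ⟨i, hi, hne⟩ : ∃ i < k + 1, f (c i) ≠ f (c (i + 1)) := by
    by_contra! hall
    have : ∀ j ≤ k + 1, f (c j) = f (c 0) := by
      intro j
      induction j with
      | zero => simp
      | succ j ih => exact fun hj => (hall j (by omega)).symm.trans (ih (by omega))
    exact h (by rw [← hc.1, ← hc.2, this (k + 1) le_rfl])
  exact (le_boundaryRho_of_le hη (hf _ _ hne)).trans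
    (Finset.single_le_sum (f := fun i => boundaryRho η (c i) (c (i + 1)))
      (fun _ _ => zero_le) (Finset.mem_range.2 hi))

end ChainMetric

/-! ### Prefixes of boundary points and their control of `d_η`. -/

section PrefixMap

variable {k : ℕ} {T : SymGenSet (FreeGroup (Fin k))} {C D : ℝ}

/-- Divergence and equivalence of sequences do not depend on `T`: they can be read off the source
vertices in the Cayley tree. -/
theorem IsPrefixComparable.gromovEquiv_iff (H : IsPrefixComparable T C D) (hD : 0 < D)
    {x y : ℕ → CayleyGraph T} : GromovEquiv (CayleyGraph.vertex T 1) x y ↔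
      ∀ N : ℕ, ∀ᶠ p : ℕ × ℕ in atTop ×ˢ atTop,
        N ≤ FreeGroup.commonPrefix (x p.1).src (y p.2).src := by
  constructor
  · intro h N
    filter_upwards [h.eventually_ge_atTop (D * N + C)] with p hp
    have h1 := hp.trans (H (x p.1) (y p.2)).2
    exact_mod_cast le_of_mul_le_mul_left (le_of_add_le_add_right h1) hD
  · intro h
    refine tendsto_atTop.2 fun b => ?_
    filter_upwards [h ⌈(b + C) * D⌉₊] with p hp
    refine le_trans ?_ (H (x p.1) (y p.2)).1
    rw [le_sub_iff_add_le, le_div_iff₀ hD]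
    exact Nat.ceil_le.1 hp

/-- The vertices of a sequence diverging to infinity eventually have a common prefix. -/
theorem IsPrefixComparable.exists_prefix (H : IsPrefixComparable T C D) (hD : 0 < D)
    (x : DivergentSeq (CayleyGraph.vertex T 1)) (N : ℕ) : ∃ l : List (Fin k × Bool), ∀ᶠ n in atTop,
      N ≤ (x.1 n).src.norm ∧ (x.1 n).src.toWord.take N = l := by
  have h := (H.gromovEquiv_iff hD).1 x.2 N
  obtain ⟨m, hm⟩ := h.curry.exists
  refine ⟨(x.1 m).src.toWord.take N, ?_⟩
  filter_upwards [hm] with n hn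
  obtain ⟨-, h2, h3⟩ := FreeGroup.le_commonPrefix_iff.1 hn
  exact ⟨h2, h3.symm⟩

/-- The prefix of length `N` of a boundary point. -/
def boundaryPrefix (H : IsPrefixComparable T C D) (hD : 0 < D) (N : ℕ) :
    groupBoundary T → List (Fin k × Bool) :=
  Quot.lift (fun x => (H.exists_prefix hD x N).choose) fun x y hxy => by
    have h1 := (H.exists_prefix hD x N).choose_spec
    have h2 := (H.exists_prefix hD y N).choose_spec
    obtain ⟨p, ⟨h3, h4⟩, h5⟩ :=
      ((h1.prod_mk h2).and ((H.gromovEquiv_iff hD).1 hxy N)).exists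
    rw [← h3.2, ← h4.2]
    exact (FreeGroup.le_commonPrefix_iff.1 h5).2.2

theorem boundaryPrefix_spec (H : IsPrefixComparable T C D) (hD : 0 < D) (N : ℕ)
    (x : DivergentSeq (CayleyGraph.vertex T 1)) : ∀ᶠ n in atTop, N ≤ (x.1 n).src.norm ∧
      (x.1 n).src.toWord.take N = boundaryPrefix H hD N (GromovBoundary.mk x) :=
  (H.exists_prefix hD x N).choose_spec

/-- One pair of late indices suffices, because both prefixes have stabilized. Contrapositively,
different prefixes eventually bound all common prefixes, for every choice of representatives. -/
theorem boundaryPrefix_eq_of_frequently (H : IsPrefixComparable T C D) (hD : 0 < D) {N : ℕ}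
    {x y : DivergentSeq (CayleyGraph.vertex T 1)} (h : ∃ᶠ p : ℕ × ℕ in atTop ×ˢ atTop,
        N ≤ FreeGroup.commonPrefix (x.1 p.1).src (y.1 p.2).src) :
    boundaryPrefix H hD N (GromovBoundary.mk x) = boundaryPrefix H hD N (GromovBoundary.mk y) := by
  obtain ⟨p, h5, h3, h4⟩ := (h.and_eventually
    ((boundaryPrefix_spec H hD N x).prod_mk (boundaryPrefix_spec H hD N y))).exists
  rw [← h3.2, ← h4.2]
  exact (FreeGroup.le_commonPrefix_iff.1 h5).2.2

theorem eventually_of_boundaryPrefix_eq (H : IsPrefixComparable T C D) (hD : 0 < D) {N : ℕ}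
    {x y : DivergentSeq (CayleyGraph.vertex T 1)}
    (h : boundaryPrefix H hD N (GromovBoundary.mk x) =
      boundaryPrefix H hD N (GromovBoundary.mk y)) :
    ∀ᶠ p : ℕ × ℕ in atTop ×ˢ atTop,
      N ≤ FreeGroup.commonPrefix (x.1 p.1).src (y.1 p.2).src := by
  filter_upwards [(boundaryPrefix_spec H hD N x).prod_mk (boundaryPrefix_spec H hD N y)]
    with p hp
  exact FreeGroup.le_commonPrefix_iff.2 ⟨hp.1.1, hp.2.1, hp.1.2.trans (h.trans hp.2.2.symm)⟩

theorem boundaryProduct_le_of_prefix_ne (H : IsPrefixComparable T C D) (hD : 0 < D) {N : ℕ}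
    {ξ ζ : groupBoundary T} (h : boundaryPrefix H hD N ξ ≠ boundaryPrefix H hD N ζ) :
    boundaryProduct ξ ζ ≤ ((D * N + C : ℝ) : EReal) := by
  refine iSup_le fun x => iSup_le fun y => iSup_le ?_
  rintro ⟨rfl, rfl⟩
  have h1 : ∀ᶠ p : ℕ × ℕ in atTop ×ˢ atTop,
      (gromovProduct (CayleyGraph.vertex T 1) (x.1 p.1) (y.1 p.2) : EReal) ≤
        ((D * N + C : ℝ) : EReal) := by
    have := not_frequently.1 (mt (boundaryPrefix_eq_of_frequently H hD) h)
    filter_upwards [this] with p hp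
    rw [EReal.coe_le_coe_iff]
    refine (H (x.1 p.1) (y.1 p.2)).2.trans ?_
    have : (FreeGroup.commonPrefix (x.1 p.1).src (y.1 p.2).src : ℝ) ≤ N := by
      exact_mod_cast (not_le.1 hp).le
    gcongr
  exact (liminf_le_liminf h1).trans (liminf_const _).le

theorem le_boundaryProduct_of_prefix_eq (H : IsPrefixComparable T C D) (hD : 0 < D) {N : ℕ}
    {ξ ζ : groupBoundary T} (h : boundaryPrefix H hD N ξ = boundaryPrefix H hD N ζ) :
    ((N / D - C : ℝ) : EReal) ≤ boundaryProduct ξ ζ := by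
  obtain ⟨x, rfl⟩ := Quot.exists_rep ξ
  obtain ⟨y, rfl⟩ := Quot.exists_rep ζ
  refine le_iSup_of_le x (le_iSup_of_le y (le_iSup_of_le ⟨rfl, rfl⟩ ?_))
  refine (liminf_const (f := (atTop : Filter ℕ) ×ˢ (atTop : Filter ℕ)) _).symm.le.trans
    (liminf_le_liminf ?_)
  filter_upwards [eventually_of_boundaryPrefix_eq H hD h] with p hp
  rw [EReal.coe_le_coe_iff]
  refine le_trans ?_ (H (x.1 p.1) (y.1 p.2)).1
  gcongr

theorem eq_of_forall_boundaryPrefix_eq (H : IsPrefixComparable T C D) (hD : 0 < D)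
    {ξ ζ : groupBoundary T} (h : ∀ N, boundaryPrefix H hD N ξ = boundaryPrefix H hD N ζ) :
    ξ = ζ := by
  obtain ⟨x, rfl⟩ := Quot.exists_rep ξ
  obtain ⟨y, rfl⟩ := Quot.exists_rep ζ
  exact Quot.sound ((H.gromovEquiv_iff hD).2 fun N => eventually_of_boundaryPrefix_eq H hD (h N))

/-- Translation by `g` shortens common prefixes by at most `g.norm`; this drives the upper bound for
the entropy. -/
theorem boundaryPrefix_smul_eq (H : IsPrefixComparable T C D) (hD : 0 < D) {N R : ℕ}
    {ξ ζ : groupBoundary T} (h : boundaryPrefix H hD N ξ = boundaryPrefix H hD N ζ)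
    {g : FreeGroup (Fin k)} (hg : R + g.norm ≤ N) :
    boundaryPrefix H hD R (g • ξ) = boundaryPrefix H hD R (g • ζ) := by
  obtain ⟨x, rfl⟩ := Quot.exists_rep ξ
  obtain ⟨y, rfl⟩ := Quot.exists_rep ζ
  refine boundaryPrefix_eq_of_frequently (x := ⟨fun n => g • x.1 n, x.2.smul g⟩)
    (y := ⟨fun n => g • y.1 n, y.2.smul g⟩) H hD (Eventually.frequently ?_)
  filter_upwards [eventually_of_boundaryPrefix_eq H hD h] with p hp
  have h1 : R + g.norm ≤ FreeGroup.commonPrefix (g * (x.1 p.1).src) (g * (y.1 p.2).src) + g.norm :=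
    hg.trans (hp.trans (FreeGroup.commonPrefix_le_mul_left g _ _))
  exact le_of_add_le_add_right h1

theorem boundaryRho_le_of_prefix_eq (H : IsPrefixComparable T C D) (hD : 0 < D) {N : ℕ} {η : ℝ}
    (hη : 0 ≤ η) {ξ ζ : groupBoundary T}
    (h : boundaryPrefix H hD N ξ = boundaryPrefix H hD N ζ) :
    boundaryRho η ξ ζ ≤ ENNReal.ofReal (Real.exp (-(η * (N / D - C)))) :=
  boundaryRho_le_of_le hη (le_boundaryProduct_of_prefix_eq H hD h)

theorem le_boundaryDist_of_prefix_ne (H : IsPrefixComparable T C D) (hD : 0 < D) {N : ℕ} {η : ℝ}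
    (hη : 0 ≤ η) {ξ ζ : groupBoundary T}
    (h : boundaryPrefix H hD N ξ ≠ boundaryPrefix H hD N ζ) :
    ENNReal.ofReal (Real.exp (-(η * (D * N + C)))) ≤ boundaryDist η ξ ζ :=
  le_boundaryDist_of_ne hη _ (fun _ _ h => boundaryProduct_le_of_prefix_ne H hD h) h

theorem exists_exp_lt (hD : 0 < D) {η : ℝ} (hη : 0 < η) (C : ℝ) {θ : ℝ} (hθ : 0 < θ) :
    ∃ N : ℕ, Real.exp (-(η * (N / D - C))) < θ := by
  have h : Tendsto (fun N : ℕ => η * ((N : ℝ) / D - C)) atTop atTop :=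
    (tendsto_atTop_add_const_right _ (-C)
      (tendsto_natCast_atTop_atTop.atTop_div_const hD)).const_mul_atTop hη
  exact ((Real.tendsto_exp_neg_atTop_nhds_zero.comp h).eventually (gt_mem_nhds hθ)).exists

/-- The boundary of a Cayley graph of a free group is metrized by `d_η` for all `η > 0`. -/
theorem isBoundaryMetric_freeGroup (T : SymGenSet (FreeGroup (Fin k))) {η : ℝ} (hη : 0 < η) :
    IsBoundaryMetric (CayleyGraph.vertex T 1) η := by
  obtain ⟨C, D, hD, H⟩ := exists_isPrefixComparable T
  refine ⟨fun ξ ζ => ?_, fun ξ ζ => ⟨fun h => ?_, ?_⟩, fun ξ ζ =>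
    le_antisymm (boundaryDist_le_comm η ξ ζ) (boundaryDist_le_comm η ζ ξ), boundaryDist_triangle η⟩
  · have h0 : boundaryPrefix H hD 0 ξ = boundaryPrefix H hD 0 ζ := by
      obtain ⟨x, rfl⟩ := Quot.exists_rep ξ
      obtain ⟨y, rfl⟩ := Quot.exists_rep ζ
      exact boundaryPrefix_eq_of_frequently H hD (Eventually.frequently (by simp))
    exact ne_top_of_le_ne_top ENNReal.ofReal_ne_top ((boundaryDist_le_boundaryRho η ξ ζ).trans
      (boundaryRho_le_of_prefix_eq H hD hη.le h0))
  · refine eq_of_forall_boundaryPrefix_eq H hD fun N => ?_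
    by_contra hne
    have := le_boundaryDist_of_prefix_ne H hD hη.le hne
    rw [h] at this
    exact absurd this (not_le.2 (ENNReal.ofReal_pos.2 (Real.exp_pos _)))
  · rintro rfl
    by_contra hne
    -- Every chain has at least one link, so vanishing on the diagonal is not automatic; it holds
    -- because a point shares prefixes of every length with itself.
    have hle : ∀ N, boundaryDist η ξ ξ ≤ ENNReal.ofReal (Real.exp (-(η * ((N : ℕ) / D - C)))) :=
      fun N => (boundaryDist_le_boundaryRho η ξ ξ).trans
        (boundaryRho_le_of_prefix_eq H hD hη.le rfl)
    have htop := ne_top_of_le_ne_top ENNReal.ofReal_ne_top (hle 0)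
    have hθ := ENNReal.toReal_pos hne htop
    obtain ⟨N, hN⟩ := exists_exp_lt hD hη C hθ
    have := (hle N).trans_lt ((ENNReal.ofReal_lt_ofReal_iff hθ).2 hN)
    rw [ENNReal.ofReal_toReal htop] at this
    exact lt_irrefl _ this

end PrefixMap

/-! ### Boundary entropy: counting prefixes from above, branching rays from below. -/

section BoundaryEntropy

variable {k : ℕ}

/-- At a fixed scale, the number of points separated by the standard ball of radius `n` is at most
the number of words of length `n + R`. -/
theorem exists_sepNumber_standard_le (hk : 1 ≤ k) (T : SymGenSet (FreeGroup (Fin k))) {η θ : ℝ}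
    (hη : 0 < η) (hθ : 0 < θ) : ∃ R : ℕ, ∀ n, sepNumber (standardGenSet k)
      (boundaryDist η : groupBoundary T → groupBoundary T → ℝ≥0∞) n θ ≤
        ENNReal.ofReal (2 * k * ((2 * k - 1 : ℕ) : ℝ) ^ (n + R)) := by
  classical
  obtain ⟨C, D, hD, H⟩ := exists_isPrefixComparable T
  -- Points with a common prefix of length `R` are closer than `θ`. Agreement up to `n + R` leaves
  -- agreement up to `R` after translation by the ball of radius `n`, so separated points have
  -- different prefixes of length `n + R`.
  obtain ⟨R, hR⟩ := exists_exp_lt hD hη C hθ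
  refine ⟨R, fun n => iSup₂_le fun A hA => ?_⟩
  obtain ⟨W, hW, -, hcard⟩ := exists_finset_norm_eq hk (n + R)
  let f : groupBoundary T → FreeGroup (Fin k) := fun ξ =>
    FreeGroup.mk (boundaryPrefix H hD (n + R) ξ)
  have hred : ∀ ξ : groupBoundary T, FreeGroup.IsReduced (boundaryPrefix H hD (n + R) ξ) ∧
      (boundaryPrefix H hD (n + R) ξ).length = n + R := by
    intro ξ
    obtain ⟨x, rfl⟩ := Quot.exists_rep ξ
    obtain ⟨m, hm1, hm2⟩ := (boundaryPrefix_spec H hD (n + R) x).exists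
    change FreeGroup.IsReduced (boundaryPrefix H hD (n + R) (GromovBoundary.mk x)) ∧
      (boundaryPrefix H hD (n + R) (GromovBoundary.mk x)).length = n + R
    rw [← hm2]
    refine ⟨FreeGroup.isReduced_toWord.infix (List.take_prefix _ _).isInfix, ?_⟩
    rw [List.length_take]
    exact min_eq_left hm1
  have hmaps : ∀ ξ ∈ A, f ξ ∈ W := fun ξ _ => (hW _).2 (by
    rw [FreeGroup.norm_mk_of_isReduced (hred ξ).1, (hred ξ).2])
  have hinj : Set.InjOn f A := by
    intro ξ hξ ζ hζ h
    by_contra hne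
    have h1 : boundaryPrefix H hD (n + R) ξ = boundaryPrefix H hD (n + R) ζ := by
      have := congrArg FreeGroup.toWord h
      rwa [FreeGroup.toWord_mk, FreeGroup.toWord_mk, (hred ξ).1.reduce_eq,
        (hred ζ).1.reduce_eq] at this
    obtain ⟨g, hg, hle⟩ := hA ξ hξ ζ hζ hne
    have hgn : g.norm ≤ n := (norm_le_length_standard g).trans hg
    have h2 := boundaryPrefix_smul_eq H hD (R := R) h1 (g := g) (by omega)
    have h3 := hle.trans ((boundaryDist_le_boundaryRho η _ _).trans
      (boundaryRho_le_of_prefix_eq H hD hη.le h2))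
    exact absurd h3 (not_le.2 ((ENNReal.ofReal_lt_ofReal_iff hθ).2 hR))
  have h4 : A.card ≤ 2 * k * (2 * k - 1) ^ (n + R) :=
    (Finset.card_le_card_of_injOn f hmaps hinj).trans hcard
  rw [← ENNReal.ofReal_natCast]
  refine ENNReal.ofReal_le_ofReal ?_
  exact_mod_cast h4

theorem boundaryEntropy_standard_le (hk : 1 ≤ k) (T : SymGenSet (FreeGroup (Fin k))) {η : ℝ}
    (hη : 0 < η) :
    boundaryEntropy (standardGenSet k) T η ≤ (Real.log ((2 * k - 1 : ℕ) : ℝ) : EReal) := by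
  have hq : (0 : ℝ) < ((2 * k - 1 : ℕ) : ℝ) := by exact_mod_cast (by omega : 0 < 2 * k - 1)
  refine iSup₂_le fun θ hθ => ?_
  obtain ⟨R, hR⟩ := exists_sepNumber_standard_le hk T hη hθ
  have hC : (0 : ℝ) < 2 * k * ((2 * k - 1 : ℕ) : ℝ) ^ R := by positivity
  refine limsup_log_div_le (N := id) (r := fun n => _ * ((n : ℝ) + 1) ^ (0 : ℤ) * _ ^ n) ?_ ?_
    (tendsto_log_mul_zpow_mul_pow_div hC hq 0 tendsto_id)
  · intro n
    positivity
  · refine .of_forall fun n => (hR n).trans (le_of_eq (congrArg _ ?_))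
    rw [pow_add, zpow_zero]
    ring

theorem gromovEquiv_vertex_mul_pow (T : SymGenSet (FreeGroup (Fin k))) {w a : FreeGroup (Fin k)}
    (ha : ∀ n, (a ^ n).norm = n ∧ (w * a ^ n).norm = w.norm + n) :
    GromovEquiv (CayleyGraph.vertex T 1) (fun n => CayleyGraph.vertex T (w * a ^ n))
      (fun n => CayleyGraph.vertex T (w * a ^ n)) := by
  obtain ⟨C, D, hD, H⟩ := exists_isPrefixComparable T
  have key : ∀ i j, i ≤ j → i ≤ FreeGroup.commonPrefix (w * a ^ i) (w * a ^ j) := by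
    intro i j hij
    obtain ⟨d, rfl⟩ := Nat.exists_eq_add_of_le hij
    have h : (w * a ^ i * a ^ d).norm = (w * a ^ i).norm + (a ^ d).norm := by
      rw [mul_assoc, ← pow_add, (ha _).2, (ha i).2, (ha d).1, add_assoc]
    rw [pow_add, ← mul_assoc, FreeGroup.commonPrefix_mul_right h, (ha i).2]
    exact Nat.le_add_left _ _
  refine (H.gromovEquiv_iff hD).2 fun N => ?_
  filter_upwards [(eventually_ge_atTop N).prod_mk (eventually_ge_atTop N)] with p hp
  change N ≤ FreeGroup.commonPrefix (w * a ^ p.1) (w * a ^ p.2)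
  rcases le_total p.1 p.2 with h | h
  · exact hp.1.trans (key _ _ h)
  · rw [FreeGroup.commonPrefix_comm]
    exact hp.2.trans (key _ _ h)

/-- Every element `w` is a prefix of a boundary point, in such a way that the boundary points of
different elements of the same length branch where the elements do. -/
theorem exists_boundary_extension (hk : 1 ≤ k) (T : SymGenSet (FreeGroup (Fin k))) {C D : ℝ}
    (H : IsPrefixComparable T C D) (hD : 0 < D) :
    ∃ e : FreeGroup (Fin k) → groupBoundary T, ∀ w w', w.norm = w'.norm → w ≠ w' →
      ∃ u b, w = u * b ∧ w.norm = u.norm + b.norm ∧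
        boundaryPrefix H hD 1 (u⁻¹ • e w) ≠ boundaryPrefix H hD 1 (u⁻¹ • e w') := by
  choose a ha using FreeGroup.exists_norm_mul_pow (⟨0, hk⟩ : Fin k)
  let x : FreeGroup (Fin k) → DivergentSeq (CayleyGraph.vertex T 1) := fun w =>
    ⟨fun n => CayleyGraph.vertex T (w * a w ^ n), gromovEquiv_vertex_mul_pow T (ha w)⟩
  refine ⟨fun w => GromovBoundary.mk (x w), fun w w' hnorm hne => ?_⟩
  obtain ⟨u, b, b', hb, hb', -, h2, h3, h4⟩ := FreeGroup.exists_branch w w'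
  refine ⟨u, b, hb, h2, fun heq => ?_⟩
  have hbb : b.norm = b'.norm := by omega
  -- Equality of norms excludes that one element is a proper prefix of the other, in which case the
  -- extensions could coincide.
  have hb0 : b.norm ≠ 0 := by
    intro h0
    refine hne ?_
    have hb1 : b = 1 := FreeGroup.norm_eq_zero.1 h0
    have hb1' : b' = 1 := FreeGroup.norm_eq_zero.1 (hbb ▸ h0)
    rw [hb, hb', hb1, hb1']
  have hcp : FreeGroup.commonPrefix b b' = 0 := by
    have h5 := FreeGroup.norm_inv_mul_add b b'
    have h6 : w⁻¹ * w' = b⁻¹ * b' := by rw [hb, hb']; group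
    rw [← h6] at h5
    omega
  have key : ∀ (w c : FreeGroup (Fin k)), w = u * c → w.norm = u.norm + c.norm → c.norm ≠ 0 →
      ∀ n, 1 ≤ FreeGroup.commonPrefix c (u⁻¹ * (w * a w ^ n)) := by
    intro w c hwc hnc hc n
    have h7 : u⁻¹ * (w * a w ^ n) = c * a w ^ n := by rw [hwc]; group
    have h8 : (c * a w ^ n).norm = c.norm + (a w ^ n).norm := by
      refine le_antisymm (FreeGroup.norm_mul_le _ _) ?_
      have h9 := FreeGroup.norm_mul_le u (c * a w ^ n)
      rw [← mul_assoc, ← hwc, (ha w n).2] at h9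
      rw [(ha w n).1]
      omega
    rw [h7, FreeGroup.commonPrefix_mul_right h8]
    omega
  obtain ⟨p, hp⟩ := (eventually_of_boundaryPrefix_eq (N := 1)
    (x := ⟨fun n => u⁻¹ • (x w).1 n, (x w).2.smul u⁻¹⟩)
    (y := ⟨fun n => u⁻¹ • (x w').1 n, (x w').2.smul u⁻¹⟩) H hD heq).exists
  have hp' : 1 ≤ FreeGroup.commonPrefix (u⁻¹ * (w * a w ^ p.1)) (u⁻¹ * (w' * a w' ^ p.2)) := hp
  have h10 := key w b hb h2 hb0 p.1
  have h11 := key w' b' hb' h3 (hbb ▸ hb0) p.2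
  -- After translation by `u⁻¹` the two rays begin like `b` and `b'`, whose first letters differ.
  have h12 := FreeGroup.min_commonPrefix_le b (u⁻¹ * (w * a w ^ p.1)) (u⁻¹ * (w' * a w' ^ p.2))
  have h13 := FreeGroup.min_commonPrefix_le b (u⁻¹ * (w' * a w' ^ p.2)) b'
  rw [FreeGroup.commonPrefix_comm _ b'] at h13
  omega

/-- Among the elements of a ball, many have the same length in the Cayley tree. -/
theorem exists_finset_ball_norm_eq (hk : 1 ≤ k) (S : SymGenSet (FreeGroup (Fin k))) :
    ∃ E : ℕ, ∀ n, ∃ (r : ℕ) (W : Finset (FreeGroup (Fin k))),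
      (∀ w ∈ W, S.length w ≤ n ∧ w.norm = r) ∧
      ((2 * k - 1 : ℕ) : ℝ) ^ n / ((E + 1) * (n + 1)) ≤ W.card := by
  classical
  obtain ⟨E, hE⟩ : ∃ E, ∀ t ∈ S.carrier, t.norm ≤ E :=
    ⟨S.carrier.sup FreeGroup.norm, fun t ht => Finset.le_sup (f := FreeGroup.norm) ht⟩
  refine ⟨E, fun n => ?_⟩
  set B := (S.finite_ball n).toFinset with hB
  have hmem : ∀ w ∈ B, S.length w ≤ n := fun w hw => (S.finite_ball n).mem_toFinset.1 hw
  have hBcard : (2 * k - 1) ^ n ≤ B.card := by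
    rw [hB, ← Set.ncard_eq_toFinset_card _ (S.finite_ball n)]
    exact pow_le_ncard_ball hk S n
  have hpos : (0 : ℝ) < (E + 1) * (n + 1) := by positivity
  -- Norms on the ball take at most `E * n + 1` values, so the most frequent one costs only a
  -- polynomial factor.
  obtain ⟨r, -, hr⟩ := Finset.exists_le_card_fiber_of_nsmul_le_card_of_maps_to (s := B)
    (t := Finset.range (E * n + 1)) (f := FreeGroup.norm)
    (b := ((2 * k - 1 : ℕ) : ℝ) ^ n / ((E + 1) * (n + 1))) (fun w hw => by
      rw [Finset.mem_range, Nat.lt_succ_iff]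
      exact (exists_norm_le_mul_length S hE w).trans (Nat.mul_le_mul_left _ (hmem w hw)))
    ⟨0, by simp⟩ (by
      rw [Finset.card_range, nsmul_eq_mul]
      have h1 : (((2 * k - 1) ^ n : ℕ) : ℝ) ≤ B.card := Nat.cast_le.2 hBcard
      rw [Nat.cast_pow] at h1
      refine le_trans ?_ h1
      rw [mul_div_assoc', div_le_iff₀ hpos, mul_comm]
      refine mul_le_mul_of_nonneg_left ?_ (by positivity)
      push_cast
      have hE0 : (0 : ℝ) ≤ E := Nat.cast_nonneg E
      have hn0 : (0 : ℝ) ≤ n := Nat.cast_nonneg n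
      linarith)
  refine ⟨r, B.filter fun w => w.norm = r, fun w hw => ?_, hr⟩
  obtain ⟨h1, h2⟩ := Finset.mem_filter.1 hw
  exact ⟨hmem w h1, h2⟩

/-- The branch point `u` of two elements of `B(n - c)` is a tree prefix of them, so it has length at
most `n` by additivity of `S`-length up to `c`. Its inverse makes the first letters of the two
boundary points differ, hence separates them at a scale independent of `n`. -/
theorem log_le_boundaryEntropy (hk : 1 ≤ k) (S T : SymGenSet (FreeGroup (Fin k))) {η : ℝ}
    (hη : 0 < η) : (Real.log ((2 * k - 1 : ℕ) : ℝ) : EReal) ≤ boundaryEntropy S T η := by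
  classical
  have hq : (0 : ℝ) < ((2 * k - 1 : ℕ) : ℝ) := by exact_mod_cast (by omega : 0 < 2 * k - 1)
  obtain ⟨C, D, hD, H⟩ := exists_isPrefixComparable T
  obtain ⟨e, he⟩ := exists_boundary_extension hk T H hD
  obtain ⟨E, hE⟩ := exists_finset_ball_norm_eq hk S
  obtain ⟨c, hc⟩ := exists_length_add_le S
  set q : ℝ := ((2 * k - 1 : ℕ) : ℝ) with hqdef
  have hC : 0 < (q ^ c * (E + 1))⁻¹ := by positivity
  refine le_iSup₂_of_le (Real.exp (-(η * (D * (1 : ℕ) + C)))) (Real.exp_pos _) ?_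
  refine le_limsup_log_div (N := id) (r := fun n => _ * ((n : ℝ) + 1) ^ (-1 : ℤ) * _ ^ n) ?_ ?_
    (tendsto_log_mul_zpow_mul_pow_div hC hq (-1) tendsto_id)
  · intro n
    positivity
  filter_upwards [eventually_ge_atTop c] with n hn
  obtain ⟨r, W, hW, hcard⟩ := hE (n - c)
  have hsep : ∀ w ∈ W, ∀ w' ∈ W, w ≠ w' → ∃ g ∈ S.ball n,
      boundaryPrefix H hD 1 (g • e w) ≠ boundaryPrefix H hD 1 (g • e w') := by
    intro w hw w' hw' hne
    obtain ⟨u, b, hub, hnorm, hpre⟩ := he w w' ((hW w hw).2.trans (hW w' hw').2.symm) hne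
    refine ⟨u⁻¹, ?_, hpre⟩
    have h1 := hc u b (by rw [← hub, hnorm])
    have h2 := (hW w hw).1
    rw [← hub] at h1
    change S.length u⁻¹ ≤ n
    rw [S.length_inv]
    omega
  have hinj : Set.InjOn e W := by
    intro w hw w' hw' h
    by_contra hne
    obtain ⟨g, -, hg⟩ := hsep w hw w' hw' hne
    exact hg (by rw [h])
  refine le_trans (b := ((W.image e).card : ℝ≥0∞)) ?_
    (le_iSup₂_of_le (W.image e) (fun ξ hξ ζ hζ hne => ?_) le_rfl)
  · rw [Finset.card_image_of_injOn hinj, ← ENNReal.ofReal_natCast]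
    refine ENNReal.ofReal_le_ofReal (le_trans ?_ hcard)
    have h1 : q ^ n = q ^ (n - c) * q ^ c := by rw [← pow_add, Nat.sub_add_cancel hn]
    have h2 : ((n - c : ℕ) : ℝ) ≤ n := by exact_mod_cast Nat.sub_le n c
    rw [h1, zpow_neg_one]
    have h3 : (q ^ c * (E + 1))⁻¹ * ((n : ℝ) + 1)⁻¹ * (q ^ (n - c) * q ^ c) =
        q ^ (n - c) / ((E + 1) * (n + 1)) := by
      have : q ^ c ≠ 0 := (pow_pos hq c).ne'
      field_simp
    rw [h3]
    gcongr
  · obtain ⟨w, hw, rfl⟩ := Finset.mem_image.1 hξ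
    obtain ⟨w', hw', rfl⟩ := Finset.mem_image.1 hζ
    obtain ⟨g, hg, hpre⟩ := hsep w hw w' hw' fun h => hne (congrArg e h)
    exact ⟨g, hg, le_boundaryDist_of_prefix_ne H hD hη.le hpre⟩

end BoundaryEntropy

end

theorem mainTheorem3 (k : ℕ) (hk : 1 ≤ k) :
    (∀ T : SymGenSet (FreeGroup (Fin k)), ∃ η₀ : ℝ, 0 < η₀ ∧
      ∀ η : ℝ, 0 < η → η < η₀ → IsBoundaryMetric (CayleyGraph.vertex T 1) η) ∧
    (∀ (T : SymGenSet (FreeGroup (Fin k)) → SymGenSet (FreeGroup (Fin k)))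
      (η : SymGenSet (FreeGroup (Fin k)) → ℝ),
      (∀ S, 0 < η S ∧ IsBoundaryMetric (CayleyGraph.vertex (T S) 1) (η S)) →
      minBoundaryEntropy T η = ((Real.log (2 * (k : ℝ) - 1) : ℝ) : EReal)) ∧
    minGrowthRate (FreeGroup (Fin k)) = ((Real.log (2 * (k : ℝ) - 1) : ℝ) : EReal) ∧
    (∀ (μ : SymGenSet (FreeGroup (Fin k)) → ℝ → ℝ → ℕ)
      (τ : SymGenSet (FreeGroup (Fin k)) → ℝ → ℝ≥0),
      minRelGrowthRate μ τ = ((Real.log (2 * (k : ℝ) - 1) : ℝ) : EReal)) := by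
  have hq : 2 * (k : ℝ) - 1 = ((2 * k - 1 : ℕ) : ℝ) := by
    rw [Nat.cast_sub (by omega)]
    push_cast
    ring
  rw [hq]
  -- The value `1` is arbitrary: every positive `η` gives a distance function.
  refine ⟨fun T => ⟨1, one_pos, fun η hη _ => isBoundaryMetric_freeGroup T hη⟩,
    fun T η h => ?_, ?_, fun μ τ => ?_⟩
  · exact le_antisymm (iInf_le_of_le (standardGenSet k) (boundaryEntropy_standard_le hk _ (h _).1))
      (le_iInf fun S => log_le_boundaryEntropy hk S _ (h S).1)
  · exact le_antisymm (iInf_le_of_le (standardGenSet k) (growthRate_standard_le hk))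
      (le_iInf fun S => log_le_growthRate hk S)
  · exact le_antisymm (iInf_le_of_le (standardGenSet k) (relGrowthRateFun_standard_le hk _ _))
      (le_iInf fun S => log_le_relGrowthRateFun hk S _ _)
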